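/- There is a function $\delta$ on the positive integers with $\delta(p)\to 0$ as $p\to\infty$ such that the following holds. For a prime $p$ and a positive integer $T \le p^{2/3}$ put $$ B(p,T)=\begin{cases} T^{19/26}\, p^{1/2+\delta(p)}, & \text{if } T\le p^{1/2},\\ T^{9/13}\, p^{27/52+\delta(p)}, & \text{if } p^{1/2}<T\le p^{29/48},\\ T\, p^{1/3+\delta(p)}, & \text{if } p^{29/48}<T\le p^{2/3}. \end{cases} $$ For every prime $p$, every subgroup $\mathcal G\subseteq\mathbb F_p^*$ of order $T\le p^{2/3}$, every $a\in\mathbb F_p^*$ and every nonprincipal multiplicative character $\chi$ of $\mathbb F_p$ (extended by $\chi(0)=0$), $$ \left|\sum_{\lambda,\mu\in\mathcal G}\chi(a+\lambda+\mu)\right|\le B(p,T). $$ Moreover, this bound is nontrivial for $T\ge p^{13/33+\varepsilon}$: for every $\varepsilon>0$ there are $\eta>0$ and $P$ such that $B(p,T)\le T^2p^{-\eta}$ for all primes $p\ge P$ and all positive integers $T$ with $p^{13/33+\varepsilon}\le T\le p^{2/3}$. -/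

import Mathlib

open Filter Topology

noncomputable section

open Classical in
/-- The double character sum over a multiplicative subgroup `G` of `𝔽_p^*`: the sum of
`χ (a + l + m)` over all pairs `l, m ∈ G`. -/
def doubleSubgroupSum (p : ℕ) [Fact p.Prime] (χ : MulChar (ZMod p) ℂ) (a : ZMod p)
    (G : Subgroup (ZMod p)ˣ) : ℂ :=
  ∑ l : G, ∑ m : G, χ (a + ((l : (ZMod p)ˣ) : ZMod p) + ((m : (ZMod p)ˣ) : ZMod p))

/-- The piecewise bound in terms of the prime `p` and the order `T`, where `e` stands for the
value of the `o(1)` in the exponent of `p`. It is used only for `T ≤ p ^ (2 / 3)`. -/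
def doubleSubgroupBound (p T : ℕ) (e : ℝ) : ℝ :=
  if (T : ℝ) ≤ (p : ℝ) ^ (1 / 2 : ℝ) then
    (T : ℝ) ^ (19 / 26 : ℝ) * (p : ℝ) ^ (1 / 2 + e : ℝ)
  else if (T : ℝ) ≤ (p : ℝ) ^ (29 / 48 : ℝ) then
    (T : ℝ) ^ (9 / 13 : ℝ) * (p : ℝ) ^ (27 / 52 + e : ℝ)
  else
    (T : ℝ) * (p : ℝ) ^ (1 / 3 + e : ℝ)

end

/-! # Double character sums over a multiplicative subgroup

Let `S ⊆ 𝔽_p^*` be the subgroup of order `T`, let `r(x)` be the number of representations of `x` as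
a difference of two elements of `S`, and let `E = ∑ r(x) ^ 2` be the additive energy of `S`.

*From the sum to the energy.* Dilating by `S` shows that the double sum has the same modulus at the
`T` shifts `a g`, `g ∈ S`. The mean square of the double sum over all shifts is computed by
orthogonality, so that `T |∑ χ(a + l + m)| ^ 2 ≤ p E` (`card_mul_norm_doubleSum_sq_le`). It remains
to bound `E`, up to powers of `log p`, by `T ^ (32 / 13)` for `T ≤ p ^ (1 / 2)` and by the larger of
`T ^ 3 p ^ (-1 / 3)` and `T ^ (31 / 13) p ^ (1 / 26)` for `T ≤ p ^ (2 / 3)`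
(`diffEnergy_pow_le_of_sq_le`, `diffEnergy_pow_le`); the latter two cross at `T = p ^ (29 / 48)`.

*Third moments.* Stepanov's method (`card_torsionPairs_le`) bounds the number of `x` whose
coset and the coset of `x - 1` form a pair from a given list. For a union `P` of cosets of `S`, this
makes the number of `x ≠ 0` with at least `ρ` representations as a difference of `P` and `S` at most
a constant times `T |P| ^ 2 / ρ ^ 3`, unless `ρ` is very small (`card_level_mul_cube_le`), whence
`∑ r(x) ^ 3 ≤ T ^ 3` and, if `P` is not too large, `∑ r_{P,S}(x) ^ 3 ≤ T |P| ^ 2` up to a logarithm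
(`sum_shiftCount_cube_le`).

*Energy.* Choose a dyadic level `P = {r ∼ u}` with `|P| u ^ 2` about `E`. As `S` acts transitively
on itself, the Cauchy–Schwarz inequality gives
`∑ r(y - z) ≥ (|P| u / T) ^ 2 E / T`, the sum running over the `x, y, z ∈ S` with `x - y, x - z ∈ P`
(`sq_mul_diffEnergy_le`). Some dyadic level `Q = {r ∼ v}` contributes a share of about `1 / log p`,
and a second application of the Cauchy–Schwarz inequality, to the triple intersections of shifts of
`S`, whose second moment is `∑ r(x) ^ 3`, leads, up to logarithms, to
`(|P| u) ^ 4 E ^ 2 ≤ T ^ 9 v ^ 2 N`, where `N` counts the pairs of elements of `P` whose difference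
lies in `Q` (`exists_level_pairCount`). For `T ≤ p ^ (1 / 2)` third moments bound `N` by
`T (|P| |Q|) ^ (3 / 4) / u` (`pow_four_mul_pairCount_le`); for larger `T` Fourier analysis bounds it
by `|P| ^ 2 |Q| / p + |P| |Q| ^ (3 / 4) (p E) ^ (1 / 4) / T` (`pairCount_le_or`). Combining either
bound with `|P| u ^ 3, |Q| v ^ 3 ≤ T ^ 3` and `|Q| v ^ 2 ≤ E` yields the estimates for `E`.

The powers of `log p` are absorbed into `p ^ δ(p)` (`lossExponent`). -/

/-! ### Polynomials with few terms -/

/-- In characteristic `p`, a nonzero polynomial of degree less than `p` cannot vanish at `1` to an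
order as large as its number of terms. The operator `X d/dX - j` removes the term of degree `j`,
keeps all the others, and lowers the order of vanishing by at most one. -/
theorem eq_zero_of_X_sub_one_pow_card_support_dvd {p : ℕ} [Fact p.Prime]
    (f : Polynomial (ZMod p)) (hdeg : ∀ i ∈ f.support, i < p)
    (hdvd : (Polynomial.X - 1) ^ f.support.card ∣ f) : f = 0 := by
  open Polynomial in
  induction hk : f.support.card generalizing f with
  | zero => simpa using hk
  | succ k ih =>
    obtain ⟨j, hj⟩ : f.support.Nonempty := by
      rw [← Finset.card_pos]; omega
    set g : (ZMod p)[X] := X * derivative f - C (j : ZMod p) * f with hg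
    have hcoeff : ∀ i, g.coeff i = ((i : ZMod p) - j) * f.coeff i := by
      intro i
      cases i with
      | zero => simp [hg]
      | succ i =>
        simp only [hg, coeff_sub, coeff_X_mul, coeff_derivative, coeff_C_mul]
        push_cast; ring
    have hsupp : g.support = f.support.erase j := by
      ext i
      rw [Finset.mem_erase, mem_support_iff, mem_support_iff, hcoeff]
      constructor
      · intro h
        refine ⟨?_, right_ne_zero_of_mul h⟩
        rintro rfl; simp at h
      · rintro ⟨hij, hi⟩
        refine mul_ne_zero (fun h => hij ?_) hi
        have h' : ((i : ℕ) : ZMod p) = (j : ℕ) := sub_eq_zero.mp h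
        rw [ZMod.natCast_eq_natCast_iff'] at h'
        rwa [Nat.mod_eq_of_lt (hdeg i (mem_support_iff.2 hi)),
          Nat.mod_eq_of_lt (hdeg j hj)] at h'
    have hcard : g.support.card = k := by
      rw [hsupp, Finset.card_erase_of_mem hj]; omega
    rw [hk] at hdvd
    have hder : (X - 1 : (ZMod p)[X]) ^ k ∣ derivative f := by
      obtain ⟨q, hq⟩ := hdvd
      rw [hq, derivative_mul, derivative_pow]
      refine dvd_add ?_ ?_
      · exact Dvd.dvd.mul_right (Dvd.dvd.mul_right (Dvd.dvd.mul_left (by simp) _) _) _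
      · exact Dvd.dvd.mul_right (pow_dvd_pow _ (Nat.le_succ k)) _
    have hg0 : g = 0 := by
      refine ih g ?_ ?_ hcard
      · intro i hi
        rw [hsupp] at hi
        exact hdeg i (Finset.mem_of_mem_erase hi)
      · rw [hcard]
        exact dvd_sub (Dvd.dvd.mul_left hder _)
          (Dvd.dvd.mul_left ((pow_dvd_pow _ (Nat.le_succ k)).trans hdvd) _)
    have hk0 : k = 0 := by rw [← hcard, hg0]; simp
    subst hk0
    -- a single term is left, and it does not vanish at `1`
    obtain ⟨i, c, hc, rfl⟩ := card_support_eq_one.mp hk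
    obtain ⟨q, hq⟩ := hdvd
    have := congrArg (eval 1) hq
    simp at this
    exact absurd this hc

/-- If a combination of the powers `(X - 1) ^ (T c)` vanishes, then `(X - 1) ^ T` divides the first
nonzero coefficient, which is impossible if this has at most `T` terms. -/
theorem eq_zero_of_sum_mul_X_sub_one_pow {p : ℕ} [Fact p.Prime] {T B : ℕ}
    (g : ℕ → Polynomial (ZMod p)) (hcard : ∀ c < B, (g c).support.card ≤ T)
    (hdeg : ∀ c < B, ∀ i ∈ (g c).support, i < p)
    (hsum : ∑ c ∈ Finset.range B, g c * (Polynomial.X - 1) ^ (T * c) = 0) :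
    ∀ c < B, g c = 0 := by
  open Polynomial in
  intro c
  induction c using Nat.strong_induction_on with
  | _ c ih =>
    intro hc
    apply eq_zero_of_X_sub_one_pow_card_support_dvd (g c) (hdeg c hc)
    refine (pow_dvd_pow _ (hcard c hc)).trans ?_
    have hne : ((X : (ZMod p)[X]) - 1) ^ (T * c) ≠ 0 := pow_ne_zero _ (X_sub_C_ne_zero 1)
    rw [← mul_dvd_mul_iff_right hne, ← pow_add]
    rw [← Finset.add_sum_erase _ _ (Finset.mem_range.2 hc)] at hsum
    rw [eq_neg_of_add_eq_zero_left hsum, dvd_neg]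
    refine Finset.dvd_sum fun i hi => ?_
    rw [Finset.mem_erase, Finset.mem_range] at hi
    rcases lt_or_gt_of_ne hi.1 with h | h
    · rw [ih i h hi.2]; simp
    · refine Dvd.dvd.mul_left (pow_dvd_pow _ ?_) _
      calc T + T * c = T * (c + 1) := by ring
        _ ≤ T * i := Nat.mul_le_mul_left _ h

/-! ### The derivation `X (X - 1) d/dX` -/

/-- The derivation `X (X - 1) d/dX`, which multiplies `X ^ m * (X - 1) ^ n` by a linear
polynomial. -/
noncomputable def eulerOp {p : ℕ} (f : Polynomial (ZMod p)) : Polynomial (ZMod p) :=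
  Polynomial.X * (Polynomial.X - 1) * Polynomial.derivative f

/-- The factor by which `k` applications of `eulerOp` multiply `X ^ m * (X - 1) ^ n`. -/
noncomputable def eulerFactor (p m n : ℕ) : ℕ → Polynomial (ZMod p)
  | 0 => 1
  | k + 1 => eulerOp (eulerFactor p m n k) +
      ((m : Polynomial (ZMod p)) * (Polynomial.X - 1) + (n : Polynomial (ZMod p)) * Polynomial.X) *
        eulerFactor p m n k

theorem natDegree_eulerFactor_le (p m n k : ℕ) [Fact p.Prime] :
    (eulerFactor p m n k).natDegree ≤ k := by
  open Polynomial in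
  induction k with
  | zero => simp [eulerFactor]
  | succ k ih =>
    rw [eulerFactor, eulerOp]
    have h1 : (X - 1 : (ZMod p)[X]).natDegree ≤ 1 := (natDegree_X_sub_C (1 : ZMod p)).le
    refine (natDegree_add_le _ _).trans (max_le ?_ ?_)
    · rcases k with _ | k
      · simp [eulerFactor]
      · have h2 : (derivative (eulerFactor p m n (k + 1))).natDegree ≤ k :=
          (natDegree_derivative_le _).trans (by omega)
        refine natDegree_mul_le.trans ?_
        refine (add_le_add (natDegree_mul_le) h2).trans ?_
        have := natDegree_X_le (R := ZMod p)
        omega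
    · refine natDegree_mul_le.trans ?_
      have h3 : ((m : (ZMod p)[X]) * (X - 1) + (n : (ZMod p)[X]) * X).natDegree ≤ 1 := by
        refine (natDegree_add_le _ _).trans (max_le ?_ ?_)
        · refine natDegree_mul_le.trans ?_
          rw [natDegree_natCast]; omega
        · refine natDegree_mul_le.trans ?_
          rw [natDegree_natCast]
          have := natDegree_X_le (R := ZMod p)
          omega
      omega

theorem eulerOp_iterate_term (p m n k : ℕ) :
    (eulerOp^[k]) ((Polynomial.X : Polynomial (ZMod p)) ^ m * (Polynomial.X - 1) ^ n) =
      eulerFactor p m n k * (Polynomial.X ^ m * (Polynomial.X - 1) ^ n) := by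
  open Polynomial in
  induction k with
  | zero => simp [eulerFactor]
  | succ k ih =>
    rw [Function.iterate_succ_apply', ih, eulerOp, derivative_mul, derivative_mul]
    have hX : X * derivative ((X : (ZMod p)[X]) ^ m) = (m : (ZMod p)[X]) * X ^ m := by
      cases m with
      | zero => simp
      | succ m =>
        rw [derivative_X_pow, Nat.add_sub_cancel, map_natCast]; ring
    have hY : (X - 1) * derivative (((X : (ZMod p)[X]) - 1) ^ n) =
        (n : (ZMod p)[X]) * (X - 1) ^ n := by
      cases n with
      | zero => simp
      | succ n =>
        rw [derivative_pow, Nat.add_sub_cancel, map_natCast]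
        simp only [derivative_sub, derivative_X, derivative_one]; ring
    rw [eulerFactor, eulerOp]
    linear_combination (eulerFactor p m n k * (X - 1) * (X - 1) ^ n) * hX +
      (eulerFactor p m n k * X * X ^ m) * hY

theorem eulerOp_iterate_sum {p : ℕ} {ι : Type*} (s : Finset ι) (l : ι → ZMod p)
    (f : ι → Polynomial (ZMod p)) (k : ℕ) :
    (eulerOp^[k]) (∑ i ∈ s, Polynomial.C (l i) * f i) =
      ∑ i ∈ s, Polynomial.C (l i) * (eulerOp^[k]) (f i) := by
  open Polynomial in
  induction k with
  | zero => simp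
  | succ k ih =>
    simp only [Function.iterate_succ_apply', ih]
    simp only [eulerOp, derivative_sum, derivative_C_mul, Finset.mul_sum]
    exact Finset.sum_congr rfl fun i _ => by ring

/-- The first nonvanishing iterate of `eulerOp` at `x` detects the order of vanishing, as long as
this order is smaller than the characteristic. -/
theorem eval_eulerOp_iterate_ne_zero {p : ℕ} [Fact p.Prime] {x : ZMod p} (hx0 : x ≠ 0)
    (hx1 : x ≠ 1) (m : ℕ) (hm : m < p) (g : Polynomial (ZMod p)) (hg : g.eval x ≠ 0) :
    ((eulerOp^[m]) ((Polynomial.X - Polynomial.C x) ^ m * g)).eval x ≠ 0 := by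
  open Polynomial in
  induction m generalizing g with
  | zero => simpa using hg
  | succ m ih =>
    rw [Function.iterate_succ_apply]
    have : eulerOp ((X - C x) ^ (m + 1) * g) =
        (X - C x) ^ m * (X * (X - 1) * (((m + 1 : ℕ) : (ZMod p)[X]) * g +
          (X - C x) * derivative g)) := by
      rw [eulerOp, derivative_mul, derivative_pow]
      simp [pow_succ]
      ring
    rw [this]
    refine ih (by omega) _ ?_
    simp only [eval_mul, eval_add, eval_sub, eval_X, eval_C, sub_self, zero_mul, add_zero,
      eval_one, eval_natCast]
    refine mul_ne_zero (mul_ne_zero hx0 (sub_ne_zero.2 hx1)) (mul_ne_zero ?_ hg)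
    rw [Ne, ZMod.natCast_eq_zero_iff]
    exact Nat.not_dvd_of_pos_of_lt (Nat.succ_pos m) hm

theorem le_rootMultiplicity_of_eulerOp {p : ℕ} [Fact p.Prime] {x : ZMod p} (hx0 : x ≠ 0)
    (hx1 : x ≠ 1) {M : ℕ} (hM : M ≤ p) {f : Polynomial (ZMod p)} (hf : f ≠ 0)
    (h : ∀ k < M, ((eulerOp^[k]) f).eval x = 0) : M ≤ f.rootMultiplicity x := by
  open Polynomial in
  by_contra! hlt
  obtain ⟨g, hg, hgx⟩ := exists_eq_pow_rootMultiplicity_mul_and_not_dvd f hf x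
  rw [dvd_iff_isRoot] at hgx
  refine eval_eulerOp_iterate_ne_zero hx0 hx1 _ (hlt.trans_le hM) g hgx ?_
  rw [← hg]
  exact h _ hlt

theorem card_mul_le_natDegree {p : ℕ} [Fact p.Prime] {f : Polynomial (ZMod p)} (M : ℕ)
    (S : Finset (ZMod p)) (h : ∀ x ∈ S, M ≤ f.rootMultiplicity x) :
    S.card * M ≤ f.natDegree := by
  open Polynomial in
  classical
  refine le_trans ?_ (card_roots' f)
  calc S.card * M ≤ ∑ x ∈ S, f.roots.count x := by
        rw [← smul_eq_mul]
        exact Finset.card_nsmul_le_sum _ _ _ fun x hx => by rw [count_roots]; exact h x hx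
    _ ≤ ∑ x ∈ S ∪ f.roots.toFinset, f.roots.count x :=
        Finset.sum_le_sum_of_subset Finset.subset_union_left
    _ = f.roots.card := by
        rw [Multiset.sum_count_eq_card]
        intro a ha
        exact Finset.mem_union_right _ (Multiset.mem_toFinset.2 ha)

/-! ### Stepanov's method -/

/-- **Stepanov's method** for the curves `x ^ T = u`, `(x - 1) ^ T = v`. One looks for a nonzero
polynomial `∑ l a b c X ^ a X ^ (T b) (X - 1) ^ (T c)` with `a < A`, `b, c < B` vanishing at all the
points to order `A`, where `A = ⌊T / B⌋`; this amounts to `#H * A * 2 A` linear conditions on `A B²`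
coefficients, and the nonzero polynomial found has degree at most `A + 2 T B`. -/
theorem card_torsionPairs_le {p : ℕ} [Fact p.Prime] {T B : ℕ} (hB : 1 ≤ B) (hBT : B ≤ T)
    (hTB : T * B ≤ p) (H : Finset (ZMod p × ZMod p)) (hH : 2 * H.card * T < B ^ 3) :
    (Finset.univ.filter fun x : ZMod p =>
      x ≠ 0 ∧ x ≠ 1 ∧ (x ^ T, (x - 1) ^ T) ∈ H).card ≤ 5 * B ^ 2 := by
  open Polynomial in
  classical
  set S := Finset.univ.filter fun x : ZMod p => x ≠ 0 ∧ x ≠ 1 ∧ (x ^ T, (x - 1) ^ T) ∈ H with hS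
  set A := T / B with hA
  have hA1 : 1 ≤ A := (Nat.one_le_div_iff (by omega)).2 hBT
  have hAB : A * B ≤ T := Nat.div_mul_le_self T B
  have hTA : T < (A + 1) * B := by
    rw [hA, mul_comm]; exact Nat.lt_mul_div_succ T (by omega)
  have hAT : A ≤ T := Nat.div_le_self T B
  have hAp : A ≤ p := hAT.trans ((Nat.le_mul_of_pos_right T hB).trans hTB)
  let I := Fin A × Fin B × Fin B
  let J := H × Fin A × Fin (2 * A)
  let q : I → ℕ → (ZMod p)[X] := fun i k =>
    eulerFactor p (i.1 + T * i.2.1) (T * i.2.2) k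
  let t : I → (ZMod p)[X] := fun i => X ^ ((i.1 : ℕ) + T * i.2.1) * (X - 1) ^ (T * (i.2.2 : ℕ))
  -- the polynomial in `x` that the `k`-th iterate becomes on the curve of `(u, v)`
  let w : ZMod p × ZMod p → ℕ → I → (ZMod p)[X] := fun h k i =>
    C (h.1 ^ (i.2.1 : ℕ) * h.2 ^ (i.2.2 : ℕ)) * (X ^ (i.1 : ℕ) * q i k)
  let Λ : (I → ZMod p) →ₗ[ZMod p] (J → ZMod p) :=
    { toFun := fun l j => ∑ i, l i * (w j.1 j.2.1 i).coeff j.2.2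
      map_add' := fun l l' => by
        ext j; simp [add_mul, Finset.sum_add_distrib]
      map_smul' := fun c l => by
        ext j; simp [Finset.mul_sum, mul_assoc] }
  have hlt : Module.finrank (ZMod p) (J → ZMod p) < Module.finrank (ZMod p) (I → ZMod p) := by
    rw [Module.finrank_fintype_fun_eq_card, Module.finrank_fintype_fun_eq_card]
    simp only [I, J, Fintype.card_prod, Fintype.card_fin, Fintype.card_coe]
    have h1 : 2 * H.card * A * B < B ^ 2 * B := by
      calc 2 * H.card * A * B = 2 * H.card * (A * B) := by ring
        _ ≤ 2 * H.card * T := Nat.mul_le_mul_left _ hAB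
        _ < B ^ 2 * B := by rw [← pow_succ]; exact hH
    have h2 : 2 * H.card * A < B ^ 2 := lt_of_mul_lt_mul_right h1 (Nat.zero_le _)
    calc H.card * (A * (2 * A)) = A * (2 * H.card * A) := by ring
      _ < A * B ^ 2 := Nat.mul_lt_mul_of_pos_left h2 hA1
      _ = A * (B * B) := by ring
  obtain ⟨l, hl, hl0⟩ := (Submodule.ne_bot_iff _).1 (LinearMap.ker_ne_bot_of_finrank_lt (f := Λ) hlt)
  set f : (ZMod p)[X] := ∑ i, C (l i) * t i with hf
  have hfD : ∀ k, (eulerOp^[k]) f = ∑ i, C (l i) * (q i k * t i) := by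
    intro k
    rw [hf, eulerOp_iterate_sum]
    exact Finset.sum_congr rfl fun i _ => by rw [eulerOp_iterate_term]
  have hcond : ∀ h ∈ H, ∀ k < A, ∑ i, C (l i) * w h k i = 0 := by
    intro h hh k hk
    ext n
    rw [finsetSum_coeff, coeff_zero]
    simp only [coeff_C_mul]
    by_cases hn : n < 2 * A
    · exact congrFun (LinearMap.mem_ker.1 hl) (⟨h, hh⟩, ⟨k, hk⟩, ⟨n, hn⟩)
    · refine Finset.sum_eq_zero fun i _ => ?_
      rw [coeff_eq_zero_of_natDegree_lt, mul_zero]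
      have h1 : (w h k i).natDegree ≤ i.1 + k := by
        refine (natDegree_C_mul_le _ _).trans (natDegree_mul_le.trans ?_)
        rw [natDegree_X_pow]
        exact Nat.add_le_add_left (natDegree_eulerFactor_le _ _ _ _) _
      have := i.1.2
      omega
  have hvan : ∀ x ∈ S, ∀ k < A, ((eulerOp^[k]) f).eval x = 0 := by
    intro x hx k hk
    have hxH := (Finset.mem_filter.1 hx).2.2.2
    have := congrArg (eval x) (hcond _ hxH k hk)
    rw [hfD, eval_finsetSum]
    rw [eval_finsetSum, eval_zero] at this
    rw [← this]
    refine Finset.sum_congr rfl fun i _ => ?_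
    simp only [w, t, eval_mul, eval_C, eval_pow, eval_X, eval_sub, eval_one]
    ring
  -- distinct pairs `(a, b)` give distinct exponents `a + T b < p`, at most `A B ≤ T` in number
  have hf0 : f ≠ 0 := by
    intro hf0
    apply hl0
    set g : ℕ → (ZMod p)[X] := fun c => ∑ a : Fin A, ∑ b : Fin B,
      if hc : c < B then C (l (a, b, ⟨c, hc⟩)) * X ^ ((a : ℕ) + T * b) else 0 with hg
    have hsupp : ∀ c, (g c).support ⊆
        (Finset.univ : Finset (Fin A × Fin B)).image fun z => (z.1 : ℕ) + T * z.2 := by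
      intro c n hn
      rw [mem_support_iff] at hn
      simp only [hg, finsetSum_coeff] at hn
      obtain ⟨a, -, ha⟩ := Finset.exists_ne_zero_of_sum_ne_zero hn
      obtain ⟨b, -, hb⟩ := Finset.exists_ne_zero_of_sum_ne_zero ha
      refine Finset.mem_image.2 ⟨(a, b), Finset.mem_univ _, ?_⟩
      by_contra hne
      apply hb
      split_ifs with hc
      · rw [coeff_C_mul, coeff_X_pow, if_neg (Ne.symm hne), mul_zero]
      · simp
    have hgz : ∀ c < B, g c = 0 := by
      refine eq_zero_of_sum_mul_X_sub_one_pow (T := T) g ?_ ?_ ?_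
      · intro c _
        refine (Finset.card_le_card (hsupp c)).trans (Finset.card_image_le.trans ?_)
        simpa using hAB
      · intro c _ i hi
        obtain ⟨⟨a, b⟩, -, rfl⟩ := Finset.mem_image.1 (hsupp c hi)
        have h1 : (a : ℕ) < T := a.2.trans_le hAT
        calc (a : ℕ) + T * b < T + T * b := by omega
          _ = T * (b + 1) := by ring
          _ ≤ T * B := Nat.mul_le_mul_left _ b.2
          _ ≤ p := hTB
      · rw [← hf0, hf, Finset.sum_range]
        simp only [I, Fintype.sum_prod_type]
        simp only [hg, Finset.sum_mul, Fin.is_lt, dite_true]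
        rw [Finset.sum_comm]
        refine Finset.sum_congr rfl fun a _ => ?_
        rw [Finset.sum_comm]
        refine Finset.sum_congr rfl fun b _ => Finset.sum_congr rfl fun c _ => ?_
        simp only [t, mul_assoc]
    funext ⟨a, b, c⟩
    have := congrArg (fun P => coeff P ((a : ℕ) + T * b)) (hgz c c.2)
    simp only [hg, finsetSum_coeff, Fin.is_lt, dite_true, coeff_zero, coeff_C_mul,
      coeff_X_pow] at this
    rw [Finset.sum_eq_single a, Finset.sum_eq_single b] at this
    · simpa using this
    · intro b' _ hb'
      rw [if_neg, mul_zero]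
      intro h
      apply hb'
      have hT : 0 < T := by omega
      exact Fin.ext (Nat.eq_of_mul_eq_mul_left hT (Nat.add_left_cancel h)).symm
    · simp
    · intro a' _ ha'
      refine Finset.sum_eq_zero fun b' _ => ?_
      rw [if_neg, mul_zero]
      intro h
      apply ha'
      have h1 := congrArg (· % T) h
      simp only [Nat.add_mul_mod_self_left] at h1
      rw [Nat.mod_eq_of_lt (a.2.trans_le hAT), Nat.mod_eq_of_lt (a'.2.trans_le hAT)] at h1
      exact Fin.ext h1.symm
    · simp
  have hmain : S.card * A ≤ f.natDegree := by
    refine card_mul_le_natDegree A S fun x hx => ?_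
    have hx' := (Finset.mem_filter.1 hx).2
    exact le_rootMultiplicity_of_eulerOp hx'.1 hx'.2.1 hAp hf0 (hvan x hx)
  have hdeg : f.natDegree ≤ A + 2 * T * B := by
    refine natDegree_sum_le_of_forall_le _ _ fun i _ => ?_
    refine (natDegree_C_mul_le _ _).trans (natDegree_mul_le.trans ?_)
    rw [natDegree_X_pow]
    have h1 : (X - 1 : (ZMod p)[X]).natDegree ≤ 1 := (natDegree_X_sub_C (1 : ZMod p)).le
    have h2 := natDegree_pow_le_of_le (T * (i.2.2 : ℕ)) h1
    have h3 : T * (i.2.1 : ℕ) ≤ T * B := Nat.mul_le_mul_left _ i.2.1.2.le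
    have h4 : T * (i.2.2 : ℕ) ≤ T * B := Nat.mul_le_mul_left _ i.2.2.2.le
    have h5 := i.1.2
    nlinarith
  have hT2 : T ≤ 2 * A * B := by nlinarith
  have : S.card * A ≤ (5 * B ^ 2) * A := by
    calc S.card * A ≤ A + 2 * T * B := hmain.trans hdeg
      _ ≤ A + 2 * (2 * A * B) * B := by gcongr
      _ = (1 + 4 * B ^ 2) * A := by ring
      _ ≤ (5 * B ^ 2) * A := by
        gcongr
        nlinarith
  exact Nat.le_of_mul_le_mul_right this hA1

/-! ### Sets invariant under a multiplicative subgroup -/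

/-- The subgroup of `𝔽_p^*` of elements of order dividing `T`, as a set of residues. -/
def torsionSet (p T : ℕ) [Fact p.Prime] : Finset (ZMod p) :=
  Finset.univ.filter fun x => x ^ T = 1

/-- A set of nonzero residues that is a union of cosets of `torsionSet p T`. -/
def IsTorsionInvariant {p : ℕ} (T : ℕ) (P : Finset (ZMod p)) : Prop :=
  0 ∉ P ∧ ∀ g x : ZMod p, g ^ T = 1 → x ∈ P → g * x ∈ P

/-- The number of `a ∈ S` with `x + a ∈ P`, that is, the number of representations of `x` as a
difference of an element of `P` and an element of `S`. -/
def shiftCount {p : ℕ} (S P : Finset (ZMod p)) (x : ZMod p) : ℕ :=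
  (S.filter fun a => x + a ∈ P).card

theorem mem_torsionSet {p T : ℕ} [Fact p.Prime] {x : ZMod p} :
    x ∈ torsionSet p T ↔ x ^ T = 1 := by
  simp [torsionSet]

theorem ne_zero_of_pow_eq_one {p T : ℕ} [Fact p.Prime] (hT : 1 ≤ T) {x : ZMod p}
    (hx : x ^ T = 1) : x ≠ 0 := by
  rintro rfl
  rw [zero_pow (by omega)] at hx
  exact zero_ne_one hx

theorem isTorsionInvariant_torsionSet {p T : ℕ} [Fact p.Prime] (hT : 1 ≤ T) :
    IsTorsionInvariant T (torsionSet p T) := by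
  refine ⟨fun h => ne_zero_of_pow_eq_one hT (mem_torsionSet.1 h) rfl, fun g x hg hx => ?_⟩
  rw [mem_torsionSet] at *
  rw [mul_pow, hg, hx, one_mul]

theorem IsTorsionInvariant.mem_of_pow_eq {p T : ℕ} [Fact p.Prime] {P : Finset (ZMod p)}
    (hP : IsTorsionInvariant T P) {x y : ZMod p} (hx : x ∈ P) (h : y ^ T = x ^ T) : y ∈ P := by
  have hx0 : x ≠ 0 := fun h0 => hP.1 (h0 ▸ hx)
  have := hP.2 (y / x) x (by rw [div_pow, h, div_self (pow_ne_zero _ hx0)]) hx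
  rwa [div_mul_cancel₀ _ hx0] at this

theorem IsTorsionInvariant.card_eq {p T : ℕ} [Fact p.Prime] {P : Finset (ZMod p)}
    (hP : IsTorsionInvariant T P) :
    P.card = (torsionSet p T).card * (P.image (· ^ T)).card := by
  classical
  rw [Finset.card_eq_sum_card_image (· ^ T) P, mul_comm, ← smul_eq_mul]
  refine Finset.sum_const_nat fun v hv => ?_
  obtain ⟨x, hx, rfl⟩ := Finset.mem_image.1 hv
  have hx0 : x ≠ 0 := fun h0 => hP.1 (h0 ▸ hx)
  refine Finset.card_bij' (fun y _ => y / x) (fun g _ => g * x) ?_ ?_ ?_ ?_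
  · intro y hy
    rw [mem_torsionSet, div_pow, (Finset.mem_filter.1 hy).2, div_self (pow_ne_zero _ hx0)]
  · intro g hg
    rw [mem_torsionSet] at hg
    exact Finset.mem_filter.2 ⟨hP.2 g x hg hx, by rw [mul_pow, hg, one_mul]⟩
  · intro y _; exact div_mul_cancel₀ _ hx0
  · intro g _; exact mul_div_cancel_right₀ _ hx0

theorem shiftCount_torsion_mul {p T : ℕ} [Fact p.Prime] (hT : 1 ≤ T) {S P : Finset (ZMod p)}
    (hS : IsTorsionInvariant T S) (hP : IsTorsionInvariant T P) {g : ZMod p} (hg : g ^ T = 1)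
    (x : ZMod p) : shiftCount S P (g * x) = shiftCount S P x := by
  have hg0 := ne_zero_of_pow_eq_one hT hg
  have hg' : g⁻¹ ^ T = 1 := by rw [inv_pow, hg, inv_one]
  refine Finset.card_bij' (fun a _ => g⁻¹ * a) (fun a _ => g * a) ?_ ?_ ?_ ?_
  · intro a ha
    rw [Finset.mem_filter] at *
    refine ⟨hS.2 _ _ hg' ha.1, ?_⟩
    have := hP.2 _ _ hg' ha.2
    rwa [mul_add, inv_mul_cancel_left₀ hg0] at this
  · intro a ha
    rw [Finset.mem_filter] at *
    refine ⟨hS.2 _ _ hg ha.1, ?_⟩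
    rw [← mul_add]
    exact hP.2 _ _ hg ha.2
  · intro a _; exact mul_inv_cancel_left₀ hg0 a
  · intro a _; exact inv_mul_cancel_left₀ hg0 a

theorem sum_cast_shiftCount_mul {p : ℕ} [Fact p.Prime] {R : Type*} [CommSemiring R]
    (S P : Finset (ZMod p)) (f : ZMod p → R) :
    ∑ x, (shiftCount S P x : R) * f x = ∑ a ∈ S, ∑ b ∈ P, f (b - a) := by
  simp only [shiftCount, Finset.card_filter, Nat.cast_sum, Finset.sum_mul]
  rw [Finset.sum_comm]
  refine Finset.sum_congr rfl fun a _ => ?_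
  rw [← Equiv.sum_comp (Equiv.subRight a)]
  simp [Finset.sum_ite_mem]

theorem sum_shiftCount_mul {p : ℕ} [Fact p.Prime] (S P : Finset (ZMod p)) (f : ZMod p → ℕ) :
    ∑ x, shiftCount S P x * f x = ∑ a ∈ S, ∑ b ∈ P, f (b - a) :=
  sum_cast_shiftCount_mul S P f

theorem sum_shiftCount {p : ℕ} [Fact p.Prime] (S P : Finset (ZMod p)) :
    ∑ x, shiftCount S P x = S.card * P.card := by
  simpa using sum_shiftCount_mul S P (fun _ => 1)

theorem shiftCount_le_left {p : ℕ} (S P : Finset (ZMod p)) (x : ZMod p) :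
    shiftCount S P x ≤ S.card := Finset.card_filter_le _ _

theorem shiftCount_le_right {p : ℕ} (S P : Finset (ZMod p)) (x : ZMod p) :
    shiftCount S P x ≤ P.card :=
  Finset.card_le_card_of_injOn (x + ·) (fun _ ha => (Finset.mem_filter.1 ha).2)
    fun _ _ _ _ h => add_left_cancel h

theorem shiftCount_neg {p : ℕ} (S : Finset (ZMod p)) (x : ZMod p) :
    shiftCount S S (-x) = shiftCount S S x := by
  refine Finset.card_bij' (fun a _ => -x + a) (fun a _ => x + a) ?_ ?_ ?_ ?_
  · intro a ha
    rw [Finset.mem_filter] at *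
    exact ⟨ha.2, by rw [add_neg_cancel_left]; exact ha.1⟩
  · intro a ha
    rw [Finset.mem_filter] at *
    exact ⟨ha.2, by rw [neg_add_cancel_left]; exact ha.1⟩
  · intro a _; exact add_neg_cancel_left x a
  · intro a _; exact neg_add_cancel_left x a

theorem shiftCount_zero {p : ℕ} (S : Finset (ZMod p)) : shiftCount S S 0 = S.card := by
  simp [shiftCount]

/-! ### Level sets and third moments -/

/-- For `x ≠ 0`, dividing `x + a = b` by `a` turns representations of `x` into points `y = b / a`
of `P` with `y - 1` in the coset of `x`. -/
theorem shiftCount_torsionSet_le {p T : ℕ} [Fact p.Prime] (hT : 1 ≤ T) {P : Finset (ZMod p)}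
    (hP : IsTorsionInvariant T P) {x : ZMod p} (hx : x ≠ 0) :
    shiftCount (torsionSet p T) P x ≤
      (P.filter fun y => y ≠ 1 ∧ (y - 1) ^ T = x ^ T).card := by
  have h0 : ∀ a ∈ (torsionSet p T).filter (fun a => x + a ∈ P), a ^ T = 1 ∧ a ≠ 0 := by
    intro a ha
    have := mem_torsionSet.1 (Finset.mem_filter.1 ha).1
    exact ⟨this, ne_zero_of_pow_eq_one hT this⟩
  refine Finset.card_le_card_of_injOn (fun a => a⁻¹ * (x + a)) ?_ ?_
  · intro a ha
    obtain ⟨ha1, ha0⟩ := h0 a ha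
    have ha' : a⁻¹ ^ T = 1 := by rw [inv_pow, ha1, inv_one]
    have he : a⁻¹ * (x + a) - 1 = a⁻¹ * x := by field_simp; ring
    refine Finset.mem_coe.2 (Finset.mem_filter.2 ⟨hP.2 _ _ ha' (Finset.mem_filter.1 ha).2, ?_, ?_⟩)
    · rw [Ne, ← sub_eq_zero, he]
      exact mul_ne_zero (inv_ne_zero ha0) hx
    · rw [he, mul_pow, ha', one_mul]
  · intro a ha b hb hab
    obtain ⟨-, ha0⟩ := h0 a ha
    obtain ⟨-, hb0⟩ := h0 b hb
    have : a⁻¹ * x = b⁻¹ * x := by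
      have h := hab
      simp only [mul_add, inv_mul_cancel₀ ha0, inv_mul_cancel₀ hb0] at h
      exact add_right_cancel h
    exact inv_injective (mul_right_cancel₀ hx this)

/-- Stepanov's method for a set `V` of cosets, given by their `T`-th powers, at whose elements
`shiftCount` is at least `ρ`. -/
theorem level_mul_card_le {p T B ρ : ℕ} [Fact p.Prime] (hB : 1 ≤ B) (hBT : B ≤ T)
    (hTB : T * B ≤ p) (hT : (torsionSet p T).card = T) {P : Finset (ZMod p)}
    (hP : IsTorsionInvariant T P) (V : Finset (ZMod p))
    (hV : ∀ v ∈ V, ∃ x, x ≠ 0 ∧ ρ ≤ shiftCount (torsionSet p T) P x ∧ x ^ T = v)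
    (hh : 2 * V.card * P.card < B ^ 3) : V.card * ρ ≤ 5 * B ^ 2 := by
  classical
  have hcard := hP.card_eq
  rw [hT] at hcard
  have hS := card_torsionPairs_le hB hBT hTB ((P.image (· ^ T)) ×ˢ V) (by
    rw [Finset.card_product]
    calc 2 * ((P.image (· ^ T)).card * V.card) * T = 2 * V.card * P.card := by rw [hcard]; ring
      _ < B ^ 3 := hh)
  refine le_trans ?_ hS
  calc V.card * ρ ≤ ∑ v ∈ V, (P.filter fun y => y ≠ 1 ∧ (y - 1) ^ T = v).card := by
        rw [← smul_eq_mul]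
        refine Finset.card_nsmul_le_sum _ _ _ fun v hv => ?_
        obtain ⟨x, hx0, hx, rfl⟩ := hV v hv
        exact hx.trans (shiftCount_torsionSet_le (hB.trans hBT) hP hx0)
    _ = (V.biUnion fun v => P.filter fun y => y ≠ 1 ∧ (y - 1) ^ T = v).card := by
        rw [Finset.card_biUnion]
        intro v _ v' _ hne
        rw [Function.onFun, Finset.disjoint_left]
        intro y hy hy'
        exact hne ((Finset.mem_filter.1 hy).2.2.symm.trans (Finset.mem_filter.1 hy').2.2)
    _ ≤ _ := by
        refine Finset.card_le_card fun y hy => ?_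
        obtain ⟨v, hv, hy⟩ := Finset.mem_biUnion.1 hy
        obtain ⟨hyP, hy1, hyv⟩ := Finset.mem_filter.1 hy
        refine Finset.mem_filter.2 ⟨Finset.mem_univ _, fun h => hP.1 (h ▸ hyP), hy1, ?_⟩
        exact Finset.mem_product.2 ⟨Finset.mem_image_of_mem _ hyP, hyv ▸ hv⟩

/-- Cubic decay of the level sets of `shiftCount`, down to the level `20 #P / B` at which the
parameters of Stepanov's method hit their limits. -/
theorem card_level_mul_cube_le {p T B ρ : ℕ} [Fact p.Prime] (hB : 1 ≤ B) (hBT : B ≤ T)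
    (hTB : T * B ≤ p) (hT : (torsionSet p T).card = T) {P : Finset (ZMod p)}
    (hP : IsTorsionInvariant T P) (hPB : P.card ≤ 4 * B ^ 2) (hρ : ρ * B > 20 * P.card) :
    (Finset.univ.filter fun x => x ≠ 0 ∧ ρ ≤ shiftCount (torsionSet p T) P x).card * ρ ^ 3 ≤
      32000 * T * P.card ^ 2 := by
  classical
  set Q := Finset.univ.filter fun x => x ≠ 0 ∧ ρ ≤ shiftCount (torsionSet p T) P x with hQ
  have hT1 : 1 ≤ T := hB.trans hBT
  have hQinv : IsTorsionInvariant T Q := by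
    refine ⟨by simp [hQ], fun g x hg hx => ?_⟩
    rw [hQ, Finset.mem_filter] at *
    refine ⟨Finset.mem_univ _, mul_ne_zero (ne_zero_of_pow_eq_one hT1 hg) hx.2.1, ?_⟩
    rw [shiftCount_torsion_mul hT1 (isTorsionInvariant_torsionSet hT1) hP hg]
    exact hx.2.2
  have hQcard := hQinv.card_eq
  rw [hT] at hQcard
  set V := Q.image (· ^ T) with hV
  have hVmem : ∀ v ∈ V, ∃ x, x ≠ 0 ∧ ρ ≤ shiftCount (torsionSet p T) P x ∧ x ^ T = v := by
    intro v hv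
    obtain ⟨x, hx, rfl⟩ := Finset.mem_image.1 hv
    rw [hQ, Finset.mem_filter] at hx
    exact ⟨x, hx.2.1, hx.2.2, rfl⟩
  rcases V.eq_empty_or_nonempty with hVe | hVne
  · rw [hQcard, hVe]; simp
  have hV1 : 1 ≤ V.card := hVne.card_pos
  obtain ⟨v0, hv0⟩ := hVne
  obtain ⟨x0, -, hx0, -⟩ := hVmem v0 hv0
  have hρT : ρ ≤ T := by
    have := hx0.trans (shiftCount_le_left _ _ _); rwa [hT] at this
  have hPρ : ρ ≤ P.card := hx0.trans (shiftCount_le_right _ _ _)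
  have hρ0 : 0 < ρ := by
    rcases Nat.eq_zero_or_pos ρ with h | h
    · subst h; simp at hρ
    · exact h
  have hPT : T ≤ P.card := by
    have hPc := hP.card_eq
    rw [hT] at hPc
    rw [hPc]
    apply Nat.le_mul_of_pos_right
    rw [Finset.card_pos, Finset.image_nonempty, ← Finset.card_pos]
    omega
  suffices h : V.card * ρ ^ 3 ≤ 32000 * P.card ^ 2 by
    rw [hQcard]
    calc T * V.card * ρ ^ 3 = T * (V.card * ρ ^ 3) := by ring
      _ ≤ T * (32000 * P.card ^ 2) := Nat.mul_le_mul_left _ h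
      _ = _ := by ring
  rcases lt_or_ge (2 * V.card * P.card) (B ^ 3) with hlt | hge
  · -- the smallest admissible parameter `b` has `b ^ 3` comparable to `#V * #P`
    have hex : ∃ b : ℕ, 2 * V.card * P.card < b ^ 3 := ⟨B, hlt⟩
    obtain ⟨b, hb, hbmin⟩ : ∃ b : ℕ, 2 * V.card * P.card < b ^ 3 ∧
        ∀ m < b, ¬ 2 * V.card * P.card < m ^ 3 :=
      ⟨Nat.find hex, Nat.find_spec hex, fun m hm => Nat.find_min hex hm⟩
    have hbB : b ≤ B := by
      by_contra! h
      exact hbmin B h hlt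
    have hVP : 1 ≤ V.card * P.card := Nat.mul_pos hV1 (by omega)
    have hb2 : 2 ≤ b := by
      by_contra! h
      have : b ^ 3 ≤ 1 := by
        have : b ≤ 1 := by omega
        calc b ^ 3 ≤ 1 ^ 3 := Nat.pow_le_pow_left this 3
          _ = 1 := one_pow 3
      nlinarith
    have hb3 : b ^ 3 ≤ 16 * (V.card * P.card) := by
      have h1 := hbmin (b - 1) (by omega)
      have h2 : b ≤ 2 * (b - 1) := by omega
      calc b ^ 3 ≤ (2 * (b - 1)) ^ 3 := Nat.pow_le_pow_left h2 3
        _ = 8 * (b - 1) ^ 3 := by ring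
        _ ≤ 8 * (2 * V.card * P.card) := Nat.mul_le_mul_left _ (not_lt.1 h1)
        _ = _ := by ring
    have hmain := level_mul_card_le (by omega) (hbB.trans hBT)
      ((Nat.mul_le_mul_left _ hbB).trans hTB) hT hP V hVmem hb
    have h3 : V.card ^ 2 * (V.card * ρ ^ 3) ≤ V.card ^ 2 * (32000 * P.card ^ 2) := by
      calc V.card ^ 2 * (V.card * ρ ^ 3) = (V.card * ρ) ^ 3 := by ring
        _ ≤ (5 * b ^ 2) ^ 3 := Nat.pow_le_pow_left hmain 3
        _ = 125 * (b ^ 3) ^ 2 := by ring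
        _ ≤ 125 * (16 * (V.card * P.card)) ^ 2 := by gcongr
        _ = _ := by ring
    exact Nat.le_of_mul_le_mul_left h3 (by positivity)
  · -- otherwise a subset `W` of `V` of extremal size contradicts `hρ`
    exfalso
    have hP0 : 0 < 2 * P.card := by omega
    set m := (B ^ 3 - 1) / (2 * P.card) with hm
    have hB3 : 1 ≤ B ^ 3 := Nat.one_le_pow _ _ hB
    have hmle : m * (2 * P.card) ≤ B ^ 3 - 1 := Nat.div_mul_le_self _ _
    have hmlt : B ^ 3 - 1 < (2 * P.card) * (m + 1) := Nat.lt_mul_div_succ _ hP0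
    have hmV : m ≤ V.card := by
      have : m * (2 * P.card) ≤ V.card * (2 * P.card) := by
        calc m * (2 * P.card) ≤ B ^ 3 := by omega
          _ ≤ V.card * (2 * P.card) := by linarith
      exact Nat.le_of_mul_le_mul_right this hP0
    obtain ⟨W, hWV, hW⟩ := Finset.exists_subset_card_eq hmV
    have hmain := level_mul_card_le hB hBT hTB hT hP W (fun v hv => hVmem v (hWV hv)) (by
      rw [hW]
      calc 2 * m * P.card = m * (2 * P.card) := by ring
        _ < B ^ 3 := by omega)
    rw [hW] at hmain
    have hB3' : B ^ 3 ≤ (2 * P.card) * (m + 1) := by omega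
    rcases Nat.eq_zero_or_pos m with hm0 | hm0
    · rw [hm0] at hB3'
      have h1 : (ρ * B) * B ^ 2 ≤ (8 * P.card) * B ^ 2 := by
        calc (ρ * B) * B ^ 2 = ρ * B ^ 3 := by ring
          _ ≤ (4 * B ^ 2) * (2 * P.card * (0 + 1)) := by
              gcongr; exact hρT.trans (hPT.trans hPB)
          _ = _ := by ring
      have := Nat.le_of_mul_le_mul_right h1 (by positivity)
      omega
    · have h1 : (ρ * B) * B ^ 2 ≤ (20 * P.card) * B ^ 2 := by
        calc (ρ * B) * B ^ 2 = ρ * B ^ 3 := by ring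
          _ ≤ ρ * ((2 * P.card) * (m + m)) := by gcongr; exact hB3'.trans (by gcongr; omega)
          _ = (4 * P.card) * (m * ρ) := by ring
          _ ≤ (4 * P.card) * (5 * B ^ 2) := by gcongr
          _ = _ := by ring
      have := Nat.le_of_mul_le_mul_right h1 (by positivity)
      omega

theorem pos_of_lt_two_pow {T L : ℕ} (hT : 1 ≤ T) (hL : T < 2 ^ L) : 0 < L := by
  rcases Nat.eq_zero_or_pos L with h | h
  · subst h; simp at hL; omega
  · exact h

/-- A sum splits into the dyadic ranges of a function `r` with values below `2 ^ L`. -/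
theorem sum_le_sum_dyadic {ι : Type*} [DecidableEq ι] (s : Finset ι) (r : ι → ℕ) (f : ι → ℕ)
    (L : ℕ) (hr : ∀ x ∈ s, r x < 2 ^ L) (h0 : ∀ x ∈ s, r x = 0 → f x = 0) :
    ∑ x ∈ s, f x ≤
      ∑ k ∈ Finset.range L, ∑ x ∈ s.filter (fun x => 2 ^ k ≤ r x ∧ r x < 2 ^ (k + 1)), f x := by
  have h1 : ∑ x ∈ s, f x = ∑ x ∈ s.filter (fun x => r x ≠ 0), f x := by
    rw [Finset.sum_filter_of_ne]
    intro x hx hf h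
    exact hf (h0 x hx h)
  rw [h1, ← Finset.sum_fiberwise_of_maps_to (s := s.filter fun x => r x ≠ 0)
    (t := Finset.range L) (g := fun x => Nat.log 2 (r x))]
  · refine Finset.sum_le_sum fun k _ => Finset.sum_le_sum_of_subset fun x hx => ?_
    simp only [Finset.mem_filter] at *
    refine ⟨hx.1.1, ?_, ?_⟩
    · rw [← hx.2]; exact Nat.pow_log_le_self 2 hx.1.2
    · rw [← hx.2]; exact Nat.lt_pow_succ_log_self (by norm_num) _
  · intro x hx
    rw [Finset.mem_filter] at hx
    exact Finset.mem_range.2 (Nat.log_lt_of_lt_pow hx.2 (hr x hx.1))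

/-- The hypothesis `#P ≤ 4 * B ^ 2` is what makes the levels below `20 #P / B`, to which
`card_level_mul_cube_le` does not apply, harmless. -/
theorem sum_shiftCount_cube_le {p T B L : ℕ} [Fact p.Prime] (hB : 1 ≤ B) (hBT : B ≤ T)
    (hTB : T * B ≤ p) (hT : (torsionSet p T).card = T) (hL : T < 2 ^ L) {P : Finset (ZMod p)}
    (hP : IsTorsionInvariant T P) (hPB : P.card ≤ 4 * B ^ 2) :
    ∑ x, shiftCount (torsionSet p T) P x ^ 3 ≤ 256001 * L * T * P.card ^ 2 := by
  classical
  have hL1 : 1 ≤ L := pos_of_lt_two_pow (hB.trans hBT) hL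
  set s := shiftCount (torsionSet p T) P with hs
  have hsum : ∑ x, s x = T * P.card := by rw [hs, sum_shiftCount, hT]
  have hsT : ∀ x, s x ≤ T := fun x => by
    have := shiftCount_le_left (torsionSet p T) P x; rwa [hT] at this
  have hsP : ∀ x, s x ≤ P.card := fun x => shiftCount_le_right _ P x
  rw [← Finset.add_sum_erase _ _ (Finset.mem_univ (0 : ZMod p))]
  have hz : s 0 ^ 3 ≤ 1 * L * T * P.card ^ 2 := by
    calc s 0 ^ 3 = 1 * (s 0 * s 0 ^ 2) := by ring
      _ ≤ L * (T * P.card ^ 2) := by gcongr; exacts [hsT 0, hsP 0]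
      _ = _ := by ring
  have hnz : ∑ x ∈ Finset.univ.erase 0, s x ^ 3 ≤ L * (256000 * T * P.card ^ 2) := by
    refine (sum_le_sum_dyadic _ s _ L (fun x _ => (hsT x).trans_lt hL)
      (fun x _ h => by rw [h]; rfl)).trans ?_
    rw [← Finset.card_range L, ← smul_eq_mul, Finset.card_range]
    conv_rhs => rw [← Finset.card_range L]
    refine Finset.sum_le_card_nsmul _ _ _ fun k _ => ?_
    rcases le_or_gt (2 ^ k * B) (20 * P.card) with hk | hk
    · have hB2 : 0 < B ^ 2 := by positivity
      have h1 : B ^ 2 * ∑ x ∈ (Finset.univ.erase 0).filter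
          (fun x => 2 ^ k ≤ s x ∧ s x < 2 ^ (k + 1)), s x ^ 3 ≤
          (1600 * P.card ^ 2) * (T * P.card) := by
        rw [← hsum, Finset.mul_sum, Finset.mul_sum]
        refine (Finset.sum_le_sum fun x hx => ?_).trans
          (Finset.sum_le_sum_of_subset (Finset.subset_univ _))
        have hx2 := (Finset.mem_filter.1 hx).2.2
        have h2 : B * s x ≤ 40 * P.card := by
          calc B * s x ≤ B * 2 ^ (k + 1) := by gcongr
            _ = 2 * (2 ^ k * B) := by ring
            _ ≤ 2 * (20 * P.card) := by gcongr
            _ = _ := by ring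
        calc B ^ 2 * s x ^ 3 = (B * s x) ^ 2 * s x := by ring
          _ ≤ (40 * P.card) ^ 2 * s x := by gcongr
          _ = _ := by ring
      have h3 : B ^ 2 * ∑ x ∈ (Finset.univ.erase 0).filter
          (fun x => 2 ^ k ≤ s x ∧ s x < 2 ^ (k + 1)), s x ^ 3 ≤
          B ^ 2 * (6400 * T * P.card ^ 2) := by
        refine h1.trans ?_
        calc (1600 * P.card ^ 2) * (T * P.card) = (1600 * P.card ^ 2 * T) * P.card := by ring
          _ ≤ (1600 * P.card ^ 2 * T) * (4 * B ^ 2) := by gcongr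
          _ = _ := by ring
      refine (Nat.le_of_mul_le_mul_left h3 hB2).trans ?_
      gcongr
      norm_num
    · have h1 := card_level_mul_cube_le hB hBT hTB hT hP hPB hk
      calc _ ≤ ∑ x ∈ Finset.univ.filter (fun x => x ≠ 0 ∧ 2 ^ k ≤ s x), (2 ^ (k + 1)) ^ 3 * 1 := by
            calc _ ≤ ∑ x ∈ (Finset.univ.erase 0).filter
                  (fun x => 2 ^ k ≤ s x ∧ s x < 2 ^ (k + 1)), (2 ^ (k + 1)) ^ 3 * 1 := by
                  refine Finset.sum_le_sum fun x hx => ?_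
                  rw [mul_one]
                  exact Nat.pow_le_pow_left (Finset.mem_filter.1 hx).2.2.le 3
              _ ≤ _ := by
                  refine Finset.sum_le_sum_of_subset fun x hx => ?_
                  simp only [Finset.mem_filter, Finset.mem_erase, Finset.mem_univ] at *
                  exact ⟨trivial, hx.1.1, hx.2.1⟩
        _ = 8 * ((Finset.univ.filter fun x => x ≠ 0 ∧ 2 ^ k ≤ s x).card * (2 ^ k) ^ 3) := by
            rw [Finset.sum_const, smul_eq_mul]; ring
        _ ≤ 8 * (32000 * T * P.card ^ 2) := by gcongr
        _ = _ := by ring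
  calc _ ≤ 1 * L * T * P.card ^ 2 + L * (256000 * T * P.card ^ 2) := add_le_add hz hnz
    _ = _ := by ring

/-! ### Additive energies and triples in a subgroup -/

/-- The additive energy of `S`: the number of solutions of `a - b = c - d` in `S`, written as the
second moment of the number of representations as a difference. -/
def diffEnergy {p : ℕ} [Fact p.Prime] (S : Finset (ZMod p)) : ℕ :=
  ∑ x, shiftCount S S x ^ 2

/-- The nonzero residues whose number of representations as a difference of elements of `S` lies
in the dyadic range `[2 ^ k, 2 ^ (k + 1))`. -/
def dyadicLevel {p : ℕ} [Fact p.Prime] (S : Finset (ZMod p)) (k : ℕ) : Finset (ZMod p) :=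
  Finset.univ.filter fun x => x ≠ 0 ∧ 2 ^ k ≤ shiftCount S S x ∧ shiftCount S S x < 2 ^ (k + 1)

/-- The number of pairs of elements of `P` whose difference lies in `Q`. -/
def pairCount {p : ℕ} (P Q : Finset (ZMod p)) : ℕ :=
  ((P ×ˢ P).filter fun z => z.2 - z.1 ∈ Q).card

theorem sum_shiftCount_mul_shiftCount {p : ℕ} [Fact p.Prime] (U V S : Finset (ZMod p)) :
    ∑ w, shiftCount U S w * shiftCount V S w = ∑ y ∈ U, ∑ z ∈ V, shiftCount S S (z - y) := by
  rw [sum_shiftCount_mul]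
  refine Finset.sum_congr rfl fun y _ => ?_
  simp only [shiftCount, Finset.card_filter]
  rw [Finset.sum_comm]
  refine Finset.sum_congr rfl fun z _ => Finset.sum_congr rfl fun b _ => ?_
  rw [show b - y + z = z - y + b by ring]

theorem sum_shiftCount_right_mul {p : ℕ} [Fact p.Prime] (S P Q : Finset (ZMod p)) :
    ∑ x, shiftCount S P x * shiftCount S Q x = ∑ b ∈ P, ∑ q ∈ Q, shiftCount S S (q - b) := by
  rw [sum_shiftCount_mul, Finset.sum_comm]
  refine Finset.sum_congr rfl fun b _ => ?_
  simp only [shiftCount, Finset.card_filter]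
  have h1 : ∀ a ∈ S, ∑ c ∈ S, (if b - a + c ∈ Q then 1 else 0) =
      ∑ q ∈ Q, if q - b + a ∈ S then 1 else 0 := by
    intro a _
    rw [← Finset.card_filter, ← Finset.card_filter]
    refine Finset.card_bij' (fun c _ => b - a + c) (fun q _ => q - b + a) ?_ ?_ ?_ ?_
    · intro c hc
      rw [Finset.mem_filter] at *
      refine ⟨hc.2, ?_⟩
      rw [show b - a + c - b + a = c by ring]; exact hc.1
    · intro q hq
      rw [Finset.mem_filter] at *
      refine ⟨hq.2, ?_⟩
      rw [show b - a + (q - b + a) = q by ring]; exact hq.1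
    · intro c _; ring
    · intro q _; ring
  rw [Finset.sum_congr rfl h1, Finset.sum_comm]

/-- The second moment of the triple intersections `S ∩ (S + α) ∩ (S + β)` is the third moment of
the double ones. -/
theorem sum_card_triple_sq {p : ℕ} [Fact p.Prime] (S : Finset (ZMod p)) :
    ∑ α, ∑ β, (S.filter fun x => x - α ∈ S ∧ x - β ∈ S).card ^ 2 =
      ∑ x, shiftCount S S x ^ 3 := by
  have h1 : ∀ α, ∑ β, (S.filter fun x => x - α ∈ S ∧ x - β ∈ S).card ^ 2 =
      ∑ y ∈ S, ∑ z ∈ S, if y - α ∈ S ∧ z - α ∈ S then shiftCount S S (z - y) else 0 := by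
    intro α
    have h2 := sum_shiftCount_mul_shiftCount (S.filter fun x => x - α ∈ S)
      (S.filter fun x => x - α ∈ S) S
    rw [Finset.sum_filter] at h2
    simp only [Finset.sum_filter] at h2
    rw [← Equiv.sum_comp (Equiv.neg (ZMod p))] at h2
    convert h2 using 2 with β hβ y hy
    · rw [sq]
      simp only [shiftCount, Finset.filter_filter, Equiv.neg_apply, sub_eq_add_neg, add_comm]
    · by_cases h : y - α ∈ S <;> simp [h]
  simp only [h1]
  rw [Finset.sum_comm]
  have h3 : ∑ x, shiftCount S S x ^ 3 = ∑ x, shiftCount S S x * shiftCount S S x ^ 2 :=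
    Finset.sum_congr rfl fun x _ => by ring
  rw [h3, sum_shiftCount_mul]
  refine Finset.sum_congr rfl fun y _ => ?_
  rw [Finset.sum_comm]
  refine Finset.sum_congr rfl fun z _ => ?_
  rw [← Finset.sum_filter, Finset.sum_const, smul_eq_mul, sq]
  congr 1
  refine Finset.card_bij' (fun α _ => y - α) (fun a _ => y - a) ?_ ?_ ?_ ?_
  · intro α hα
    rw [Finset.mem_filter] at *
    exact ⟨hα.2.1, by rw [show z - y + (y - α) = z - α by ring]; exact hα.2.2⟩
  · intro a ha
    rw [Finset.mem_filter] at *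
    refine ⟨Finset.mem_univ _, by rw [sub_sub_cancel]; exact ha.1, ?_⟩
    rw [show z - (y - a) = z - y + a by ring]; exact ha.2
  · intro α _; ring
  · intro a _; ring

theorem isTorsionInvariant_dyadicLevel {p T : ℕ} [Fact p.Prime] (hT : 1 ≤ T) (k : ℕ) :
    IsTorsionInvariant T (dyadicLevel (torsionSet p T) k) := by
  refine ⟨by simp [dyadicLevel], fun g x hg hx => ?_⟩
  simp only [dyadicLevel, Finset.mem_filter, Finset.mem_univ, true_and] at *
  have hS := isTorsionInvariant_torsionSet (p := p) hT
  rw [shiftCount_torsion_mul hT hS hS hg]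
  exact ⟨mul_ne_zero (ne_zero_of_pow_eq_one hT hg) hx.1, hx.2⟩

theorem card_filter_sub_mem {p T : ℕ} [Fact p.Prime] (hT : 1 ≤ T) {P : Finset (ZMod p)}
    (hP : IsTorsionInvariant T P) {y : ZMod p} (hy : y ∈ torsionSet p T) :
    ((torsionSet p T).filter fun x => x - y ∈ P).card = shiftCount (torsionSet p T) P (-1) := by
  rw [← shiftCount_torsion_mul hT (isTorsionInvariant_torsionSet hT) hP (mem_torsionSet.1 hy) (-1)]
  simp only [shiftCount, mul_neg_one, neg_add_eq_sub]

theorem sum_shiftCount_mem {p T : ℕ} [Fact p.Prime] (hT : 1 ≤ T) {P : Finset (ZMod p)}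
    (hP : IsTorsionInvariant T P) :
    ∑ α ∈ P, shiftCount (torsionSet p T) (torsionSet p T) α =
      (torsionSet p T).card * shiftCount (torsionSet p T) P (-1) := by
  have h := sum_shiftCount_mul (torsionSet p T) (torsionSet p T) (fun x => if x ∈ P then 1 else 0)
  simp only [mul_ite, mul_one, mul_zero, Finset.sum_ite_mem, Finset.univ_inter] at h
  rw [h, ← smul_eq_mul]
  refine Finset.sum_const_nat fun y hy => ?_
  rw [← Finset.card_filter, card_filter_sub_mem hT hP hy]

/-- The triples of elements of `S` whose first element differs from the others by elements
of `P`. -/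
def starTriples {p : ℕ} (S P : Finset (ZMod p)) : Finset (ZMod p × ZMod p × ZMod p) :=
  (S ×ˢ S ×ˢ S).filter fun t => t.1 - t.2.1 ∈ P ∧ t.1 - t.2.2 ∈ P

/-- The sum on the right equals `∑ w, ∑ x ∈ S, c x w ^ 2`, where `c x w` counts the `y ∈ S` with
`x - y ∈ P` and `y + w ∈ S`. Every `y ∈ S` satisfies `x - y ∈ P` for the same number of `x ∈ S`, so
`∑ x ∈ S, c x w` is that number times `shiftCount S S w`, and the Cauchy–Schwarz inequality in `x`
applies. -/
theorem sq_mul_diffEnergy_le {p T : ℕ} [Fact p.Prime] (hT : 1 ≤ T) {P : Finset (ZMod p)}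
    (hP : IsTorsionInvariant T P) :
    shiftCount (torsionSet p T) P (-1) ^ 2 * diffEnergy (torsionSet p T) ≤
      (torsionSet p T).card * ∑ t ∈ starTriples (torsionSet p T) P,
        shiftCount (torsionSet p T) (torsionSet p T) (t.2.1 - t.2.2) := by
  set S := torsionSet p T with hS
  set d := shiftCount S P (-1) with hd
  have hlin : ∀ w, ∑ x ∈ S, shiftCount (S.filter fun y => x - y ∈ P) S w =
      d * shiftCount S S w := by
    intro w
    simp only [shiftCount, Finset.card_filter, Finset.sum_filter]
    rw [Finset.sum_comm, Finset.mul_sum]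
    refine Finset.sum_congr rfl fun y hy => ?_
    by_cases h : w + y ∈ S
    · simp only [h, if_true, mul_one]
      rw [← Finset.card_filter]
      exact card_filter_sub_mem hT hP hy
    · simp [h]
  have htrip : ∑ t ∈ starTriples S P, shiftCount S S (t.2.1 - t.2.2) =
      ∑ w, ∑ x ∈ S, shiftCount (S.filter fun y => x - y ∈ P) S w ^ 2 := by
    rw [Finset.sum_comm]
    simp only [sq, sum_shiftCount_mul_shiftCount]
    rw [starTriples, Finset.sum_filter, Finset.sum_product]
    refine Finset.sum_congr rfl fun x _ => ?_
    rw [Finset.sum_product]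
    simp only [Finset.sum_filter]
    refine Finset.sum_congr rfl fun y _ => ?_
    by_cases h : x - y ∈ P
    · simp only [h, true_and, if_true]
      refine Finset.sum_congr rfl fun z _ => ?_
      rw [← shiftCount_neg S (y - z), neg_sub]
    · simp [h]
  rw [htrip, Finset.mul_sum, diffEnergy, Finset.mul_sum]
  refine Finset.sum_le_sum fun w _ => ?_
  rw [← mul_pow, ← hlin]
  exact sq_sum_le_card_mul_sum_sq

/-- Sorting the triples `(x, y, z)` by `(x - y, x - z)` and applying the Cauchy–Schwarz inequality
to the sizes of the triple intersections that arise. -/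
theorem card_starTriples_sq_le {p : ℕ} [Fact p.Prime] (S P Q : Finset (ZMod p)) :
    ((starTriples S P).filter fun t => t.2.1 - t.2.2 ∈ Q).card ^ 2 ≤
      pairCount P Q * ∑ x, shiftCount S S x ^ 3 := by
  classical
  set N := (P ×ˢ P).filter fun z => z.2 - z.1 ∈ Q with hN
  have h1 : ((starTriples S P).filter fun t => t.2.1 - t.2.2 ∈ Q).card ≤
      ∑ z ∈ N, (S.filter fun x => x - z.1 ∈ S ∧ x - z.2 ∈ S).card := by
    rw [Finset.card_eq_sum_card_fiberwise (f := fun t => (t.1 - t.2.1, t.1 - t.2.2)) (t := N)]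
    · refine Finset.sum_le_sum fun z _ => ?_
      refine Finset.card_le_card_of_injOn (fun t => t.1) ?_ ?_
      · rintro ⟨x, y, w⟩ ht
        simp only [starTriples, Finset.coe_filter, Finset.mem_filter, Finset.mem_product,
          Set.mem_ofPred_eq] at ht ⊢
        obtain ⟨⟨⟨⟨hx, hy, hw⟩, -⟩, -⟩, rfl⟩ := ht
        simpa using ⟨hx, hy, hw⟩
      · rintro ⟨x, y, w⟩ ht ⟨x', y', w'⟩ ht' (rfl : x = x')
        simp only [Finset.coe_filter, Set.mem_ofPred_eq] at ht ht'
        have := ht.2.trans ht'.2.symm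
        simp only [Prod.mk.injEq, sub_right_inj] at this
        rw [this.1, this.2]
    · rintro ⟨x, y, w⟩ ht
      simp only [starTriples, Finset.coe_filter, Finset.mem_filter, Finset.mem_product,
        Set.mem_ofPred_eq, hN] at ht ⊢
      exact ⟨ht.1.2, by rw [sub_sub_sub_cancel_left]; exact ht.2⟩
  calc _ ≤ (∑ z ∈ N, (S.filter fun x => x - z.1 ∈ S ∧ x - z.2 ∈ S).card) ^ 2 :=
        Nat.pow_le_pow_left h1 2
    _ ≤ N.card * ∑ z ∈ N, (S.filter fun x => x - z.1 ∈ S ∧ x - z.2 ∈ S).card ^ 2 :=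
        sq_sum_le_card_mul_sum_sq
    _ ≤ N.card * ∑ z : ZMod p × ZMod p, (S.filter fun x => x - z.1 ∈ S ∧ x - z.2 ∈ S).card ^ 2 := by
        gcongr; exact Finset.subset_univ N
    _ = _ := by rw [Fintype.sum_prod_type, sum_card_triple_sq]; rfl

theorem sum_starTriples_le {p T L : ℕ} [Fact p.Prime] (hT : 1 ≤ T)
    (hcard : (torsionSet p T).card = T) (hL : T < 2 ^ L) {P : Finset (ZMod p)}
    (hP : IsTorsionInvariant T P) :
    ∑ t ∈ starTriples (torsionSet p T) P,
        shiftCount (torsionSet p T) (torsionSet p T) (t.2.1 - t.2.2) ≤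
      T ^ 2 * shiftCount (torsionSet p T) P (-1) + ∑ k ∈ Finset.range L, 2 ^ (k + 1) *
        ((starTriples (torsionSet p T) P).filter fun t =>
          t.2.1 - t.2.2 ∈ dyadicLevel (torsionSet p T) k).card := by
  classical
  set S := torsionSet p T with hS
  rw [← Finset.sum_filter_add_sum_filter_not _ (fun t => t.2.1 = t.2.2)]
  refine add_le_add ?_ ?_
  · have h1 : ((starTriples S P).filter fun t => t.2.1 = t.2.2).card ≤
        T * shiftCount S P (-1) := by
      have h2 : ∑ y ∈ S, (S.filter fun x => x - y ∈ P).card = S.card * shiftCount S P (-1) :=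
        Finset.sum_const_nat fun y hy => card_filter_sub_mem hT hP hy
      rw [hcard] at h2
      rw [← h2, ← Finset.card_sigma]
      refine Finset.card_le_card_of_injOn (fun t => ⟨t.2.1, t.1⟩) ?_ ?_
      · rintro ⟨x, y, w⟩ ht
        simp only [starTriples, Finset.coe_filter, Finset.mem_filter, Finset.mem_product,
          Set.mem_ofPred_eq] at ht
        simp only [Finset.mem_coe, Finset.mem_sigma, Finset.mem_filter]
        exact ⟨ht.1.1.2.1, ht.1.1.1, ht.1.2.1⟩
      · rintro ⟨x, y, w⟩ ht ⟨x', y', w'⟩ ht' h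
        simp only [Finset.coe_filter, Set.mem_ofPred_eq] at ht ht'
        simp only [Sigma.mk.injEq, heq_eq_eq] at h
        obtain ⟨rfl, rfl⟩ := h
        rw [← ht.2, ← ht'.2]
    calc _ ≤ ((starTriples S P).filter fun t => t.2.1 = t.2.2).card * T := by
          rw [← smul_eq_mul]
          refine Finset.sum_le_card_nsmul _ _ _ fun t _ => ?_
          rw [← hcard]; exact shiftCount_le_left _ _ _
      _ ≤ T * shiftCount S P (-1) * T := by gcongr
      _ = _ := by ring
  · have hlt : ∀ x, shiftCount S S x < 2 ^ L := fun x =>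
      (shiftCount_le_left S S x).trans_lt (hcard.trans_lt hL)
    have hdy := sum_le_sum_dyadic ((starTriples S P).filter fun t => ¬ t.2.1 = t.2.2)
      (fun t => shiftCount S S (t.2.1 - t.2.2)) (fun t => shiftCount S S (t.2.1 - t.2.2)) L
      (fun t _ => hlt _) (fun t _ h => h)
    refine hdy.trans ?_
    · refine Finset.sum_le_sum fun k _ => ?_
      rw [mul_comm, ← smul_eq_mul]
      refine (Finset.sum_le_card_nsmul _ _ (2 ^ (k + 1)) fun t ht => ?_).trans ?_
      · exact (Finset.mem_filter.1 ht).2.2.le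
      · refine nsmul_le_nsmul_left (Nat.zero_le _) (Finset.card_le_card fun t ht => ?_)
        simp only [Finset.mem_filter, dyadicLevel, Finset.mem_univ, true_and] at *
        exact ⟨ht.1.1, sub_ne_zero.2 ht.1.2, ht.2⟩

/-- The central inequality: either `P` is so small that degenerate triples dominate, or some
dyadic level `Q` carries many differences of pairs of elements of `P`. -/
theorem exists_level_pairCount {p T L Δ : ℕ} [Fact p.Prime] (hT : 1 ≤ T)
    (hcard : (torsionSet p T).card = T) (hL : T < 2 ^ L) {P : Finset (ZMod p)}
    (hP : IsTorsionInvariant T P)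
    (hΔ : ∀ x ∈ P, Δ ≤ shiftCount (torsionSet p T) (torsionSet p T) x) :
    P.card * Δ * diffEnergy (torsionSet p T) ≤ 2 * T ^ 4 ∨
    ∃ k, (P.card * Δ) ^ 4 * diffEnergy (torsionSet p T) ^ 2 ≤
      16 * T ^ 6 * L ^ 2 * (2 ^ k) ^ 2 * (pairCount P (dyadicLevel (torsionSet p T) k) *
        ∑ x, shiftCount (torsionSet p T) (torsionSet p T) x ^ 3) := by
  have hL1 : 0 < L := pos_of_lt_two_pow hT hL
  have hmain := sq_mul_diffEnergy_le hT hP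
  have hsplit := sum_starTriples_le hT hcard hL hP
  have hdeg : P.card * Δ ≤ T * shiftCount (torsionSet p T) P (-1) := by
    have := sum_shiftCount_mem hT hP
    rw [hcard] at this
    rw [← this, ← smul_eq_mul]
    exact Finset.card_nsmul_le_sum _ _ _ hΔ
  rw [hcard] at hmain
  set S := torsionSet p T with hS
  set d := shiftCount S P (-1) with hd
  set E := diffEnergy S with hE
  set W := fun k => ((starTriples S P).filter fun t => t.2.1 - t.2.2 ∈ dyadicLevel S k).card with hW
  rcases le_or_gt (d * E) (2 * T ^ 3) with h | h
  · left
    calc P.card * Δ * E ≤ T * d * E := by gcongr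
      _ = T * (d * E) := by ring
      _ ≤ T * (2 * T ^ 3) := by gcongr
      _ = _ := by ring
  right
  obtain ⟨k, -, hk⟩ := Finset.exists_max_image (Finset.range L) (fun k => 2 ^ (k + 1) * W k)
    ⟨0, Finset.mem_range.2 hL1⟩
  have hsum : ∑ j ∈ Finset.range L, 2 ^ (j + 1) * W j ≤ L * (2 ^ (k + 1) * W k) := by
    have := Finset.sum_le_card_nsmul _ _ _ hk
    rwa [Finset.card_range, smul_eq_mul] at this
  refine ⟨k, ?_⟩
  have h1 : d ^ 2 * E ≤ 4 * T * L * 2 ^ k * W k := by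
    have h2 : d ^ 2 * E ≤ T * (T ^ 2 * d + L * (2 ^ (k + 1) * W k)) :=
      hmain.trans (Nat.mul_le_mul_left _ (hsplit.trans (Nat.add_le_add_left hsum _)))
    have h3 : 2 * (T * (T ^ 2 * d)) ≤ d ^ 2 * E := by
      calc 2 * (T * (T ^ 2 * d)) = d * (2 * T ^ 3) := by ring
        _ ≤ d * (d * E) := by gcongr
        _ = _ := by ring
    have h4 : 2 * (T * (L * (2 ^ (k + 1) * W k))) = 4 * T * L * 2 ^ k * W k := by ring
    have h5 : T * (T ^ 2 * d + L * (2 ^ (k + 1) * W k)) =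
      T * (T ^ 2 * d) + T * (L * (2 ^ (k + 1) * W k)) := by ring
    omega
  calc (P.card * Δ) ^ 4 * E ^ 2 ≤ (T * d) ^ 4 * E ^ 2 := by gcongr
    _ = T ^ 4 * (d ^ 2 * E) ^ 2 := by ring
    _ ≤ T ^ 4 * (4 * T * L * 2 ^ k * W k) ^ 2 := by gcongr
    _ = 16 * T ^ 6 * L ^ 2 * (2 ^ k) ^ 2 * W k ^ 2 := by ring
    _ ≤ _ := by gcongr; exact card_starTriples_sq_le S P _

/-! ### Pairs of elements of a set with differences in a level set -/

theorem mul_pairCount_le {p Δ : ℕ} [Fact p.Prime] (S P Q : Finset (ZMod p))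
    (hΔ : ∀ x ∈ P, Δ ≤ shiftCount S S x) :
    Δ * pairCount P Q ≤ ∑ x, shiftCount S P x * shiftCount S Q x := by
  rw [sum_shiftCount_right_mul, ← Finset.sum_product', mul_comm, ← smul_eq_mul, pairCount]
  calc _ ≤ ∑ z ∈ (P ×ˢ P).filter fun z => z.2 - z.1 ∈ Q, shiftCount S S z.1 :=
        Finset.card_nsmul_le_sum _ _ _ fun z hz =>
          hΔ _ (Finset.mem_product.1 (Finset.mem_filter.1 hz).1).1
    _ = ∑ z ∈ ((P ×ˢ P).filter fun z => z.2 - z.1 ∈ Q).image (fun z => (z.2, z.2 - z.1)),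
          shiftCount S S (z.2 - z.1) := by
        rw [Finset.sum_image]
        · refine Finset.sum_congr rfl fun z _ => ?_
          rw [← shiftCount_neg]; congr 1; ring
        · rintro ⟨a, b⟩ _ ⟨a', b'⟩ _ h
          simp only [Prod.mk.injEq] at h ⊢
          obtain ⟨rfl, h⟩ := h
          exact ⟨sub_right_injective h, rfl⟩
    _ ≤ _ := by
        refine Finset.sum_le_sum_of_subset fun z hz => ?_
        obtain ⟨w, hw, rfl⟩ := Finset.mem_image.1 hz
        rw [Finset.mem_filter, Finset.mem_product] at hw
        exact Finset.mem_product.2 ⟨hw.1.2, hw.2⟩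

theorem sum_shiftCount_sq_sq_le {p T B L : ℕ} [Fact p.Prime] (hB : 1 ≤ B) (hBT : B ≤ T)
    (hTB : T * B ≤ p) (hT : (torsionSet p T).card = T) (hL : T < 2 ^ L) {P : Finset (ZMod p)}
    (hP : IsTorsionInvariant T P) (hPB : P.card ≤ 4 * B ^ 2) :
    (∑ x, shiftCount (torsionSet p T) P x ^ 2) ^ 2 ≤ 256001 * L * T ^ 2 * P.card ^ 3 := by
  set s := shiftCount (torsionSet p T) P with hs
  have h1 : (∑ x, s x ^ 2) ^ 2 ≤ (∑ x, s x) * ∑ x, s x ^ 3 := by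
    refine Finset.sum_sq_le_sum_mul_sum_of_sq_le_mul _ (fun _ _ => Nat.zero_le _)
      (fun _ _ => Nat.zero_le _) fun x _ => le_of_eq (by ring)
  refine h1.trans ?_
  rw [hs, sum_shiftCount, hT]
  calc _ ≤ T * P.card * (256001 * L * T * P.card ^ 2) := by
        gcongr; exact sum_shiftCount_cube_le hB hBT hTB hT hL hP hPB
    _ = _ := by ring

theorem pow_four_mul_pairCount_le {p T B L Δ : ℕ} [Fact p.Prime] (hB : 1 ≤ B) (hBT : B ≤ T)
    (hTB : T * B ≤ p) (hT : (torsionSet p T).card = T) (hL : T < 2 ^ L) {P Q : Finset (ZMod p)}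
    (hP : IsTorsionInvariant T P) (hPB : P.card ≤ 4 * B ^ 2)
    (hQ : IsTorsionInvariant T Q) (hQB : Q.card ≤ 4 * B ^ 2)
    (hΔ : ∀ x ∈ P, Δ ≤ shiftCount (torsionSet p T) (torsionSet p T) x) :
    (Δ * pairCount P Q) ^ 4 ≤ 256001 ^ 2 * L ^ 2 * T ^ 4 * P.card ^ 3 * Q.card ^ 3 := by
  have h1 : (Δ * pairCount P Q) ^ 2 ≤ (∑ x, shiftCount (torsionSet p T) P x ^ 2) *
      ∑ x, shiftCount (torsionSet p T) Q x ^ 2 :=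
    (Nat.pow_le_pow_left (mul_pairCount_le _ P Q hΔ) 2).trans
      (Finset.sum_mul_sq_le_sq_mul_sq _ _ _)
  calc (Δ * pairCount P Q) ^ 4 = ((Δ * pairCount P Q) ^ 2) ^ 2 := by ring
    _ ≤ ((∑ x, shiftCount (torsionSet p T) P x ^ 2) *
      ∑ x, shiftCount (torsionSet p T) Q x ^ 2) ^ 2 := by gcongr
    _ = (∑ x, shiftCount (torsionSet p T) P x ^ 2) ^ 2 *
      (∑ x, shiftCount (torsionSet p T) Q x ^ 2) ^ 2 := by ring
    _ ≤ (256001 * L * T ^ 2 * P.card ^ 3) * (256001 * L * T ^ 2 * Q.card ^ 3) :=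
        Nat.mul_le_mul (sum_shiftCount_sq_sq_le hB hBT hTB hT hL hP hPB)
          (sum_shiftCount_sq_sq_le hB hBT hTB hT hL hQ hQB)
    _ = _ := by ring

/-! ### Exponential sums -/

/-- The exponential sum over `A` at the frequency `ξ`. -/
noncomputable def expSum {p : ℕ} [Fact p.Prime] (A : Finset (ZMod p)) (ξ : ZMod p) : ℂ :=
  ∑ a ∈ A, ZMod.stdAddChar (a * ξ)

theorem sum_stdAddChar_mul {p : ℕ} [Fact p.Prime] (x : ZMod p) :
    ∑ ξ : ZMod p, (ZMod.stdAddChar (x * ξ) : ℂ) = if x = 0 then (p : ℂ) else 0 := by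
  have := AddChar.sum_mulShift x (ZMod.isPrimitive_stdAddChar p)
  simp only [ZMod.card] at this
  simp only [mul_comm x]
  convert this using 1
  split_ifs <;> simp

theorem sum_norm_sq_transform {p : ℕ} [Fact p.Prime] (f : ZMod p → ℝ) :
    ∑ ξ : ZMod p, ‖∑ x, (f x : ℂ) * ZMod.stdAddChar (x * ξ)‖ ^ 2 = p * ∑ x, f x ^ 2 := by
  have h : ∀ ξ : ZMod p, ((‖∑ x, (f x : ℂ) * ZMod.stdAddChar (x * ξ)‖ ^ 2 : ℝ) : ℂ) =
      ∑ x, ∑ y, (f x : ℂ) * f y * ZMod.stdAddChar ((x - y) * ξ) := by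
    intro ξ
    rw [Complex.ofReal_pow, ← Complex.mul_conj', map_sum, Finset.sum_mul_sum]
    refine Finset.sum_congr rfl fun x _ => Finset.sum_congr rfl fun y _ => ?_
    rw [map_mul (starRingEnd ℂ), Complex.conj_ofReal, ← AddChar.map_neg_eq_conj, sub_mul, sub_eq_add_neg,
      AddChar.map_add_eq_mul]
    ring
  have h2 : ((∑ ξ : ZMod p, ‖∑ x, (f x : ℂ) * ZMod.stdAddChar (x * ξ)‖ ^ 2 : ℝ) : ℂ) =
      ((p * ∑ x, f x ^ 2 : ℝ) : ℂ) := by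
    rw [Complex.ofReal_sum]
    simp only [h]
    rw [Finset.sum_comm]
    push_cast
    rw [Finset.mul_sum]
    refine Finset.sum_congr rfl fun x _ => ?_
    rw [Finset.sum_comm]
    simp only [← Finset.mul_sum, sum_stdAddChar_mul]
    rw [Finset.sum_eq_single x]
    · simp; ring
    · intro y _ hy
      rw [if_neg (sub_ne_zero.2 hy.symm), mul_zero]
    · simp
  exact_mod_cast h2

theorem norm_sq_expSum {p : ℕ} [Fact p.Prime] (A : Finset (ZMod p)) (ξ : ZMod p) :
    ((‖expSum A ξ‖ ^ 2 : ℝ) : ℂ) =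
      ∑ x, (shiftCount A A x : ℂ) * ZMod.stdAddChar (x * ξ) := by
  rw [sum_cast_shiftCount_mul, Complex.ofReal_pow, ← Complex.mul_conj', expSum, map_sum,
    Finset.sum_mul_sum, Finset.sum_comm]
  refine Finset.sum_congr rfl fun x _ => Finset.sum_congr rfl fun y _ => ?_
  rw [← AddChar.map_neg_eq_conj, sub_mul, sub_eq_add_neg, AddChar.map_add_eq_mul]

theorem sum_norm_sq_expSum {p : ℕ} [Fact p.Prime] (A : Finset (ZMod p)) :
    ∑ ξ, ‖expSum A ξ‖ ^ 2 = p * A.card := by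
  have h := sum_norm_sq_transform (fun x => if x ∈ A then 1 else 0)
  simpa [expSum, Finset.sum_ite_mem, apply_ite, ite_mul] using h

theorem sum_norm_pow_four_expSum {p : ℕ} [Fact p.Prime] (A : Finset (ZMod p)) :
    ∑ ξ, ‖expSum A ξ‖ ^ 4 = p * diffEnergy A := by
  have h := sum_norm_sq_transform (fun x => (shiftCount A A x : ℝ))
  simp only [Complex.ofReal_natCast, ← norm_sq_expSum] at h
  rw [diffEnergy]
  push_cast
  rw [← h]
  refine Finset.sum_congr rfl fun ξ _ => ?_
  rw [Complex.norm_real, norm_pow, norm_norm]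
  ring

theorem sum_pow_four_le {ι : Type*} (s : Finset ι) (f : ι → ℝ) :
    (∑ x ∈ s, f x) ^ 4 ≤ s.card ^ 3 * ∑ x ∈ s, f x ^ 4 := by
  have h1 : (∑ x ∈ s, f x) ^ 2 ≤ s.card * ∑ x ∈ s, f x ^ 2 := sq_sum_le_card_mul_sum_sq
  have h2 : (∑ x ∈ s, f x ^ 2) ^ 2 ≤ s.card * ∑ x ∈ s, (f x ^ 2) ^ 2 := sq_sum_le_card_mul_sum_sq
  calc (∑ x ∈ s, f x) ^ 4 = ((∑ x ∈ s, f x) ^ 2) ^ 2 := by ring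
    _ ≤ (s.card * ∑ x ∈ s, f x ^ 2) ^ 2 := by gcongr
    _ = s.card ^ 2 * (∑ x ∈ s, f x ^ 2) ^ 2 := by ring
    _ ≤ s.card ^ 2 * (s.card * ∑ x ∈ s, (f x ^ 2) ^ 2) := by gcongr
    _ = s.card ^ 3 * ∑ x ∈ s, f x ^ 4 := by
      simp only [← pow_mul]; ring

/-- Averaging over the subgroup shows `T * expSum Q ξ = ∑ x ∈ Q, expSum S (x ξ)`; the frequencies
`x ξ` are distinct, so the fourth moment of `expSum S` over all frequencies applies. -/
theorem norm_expSum_pow_four_le {p T : ℕ} [Fact p.Prime] (hT : 1 ≤ T)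
    (hcard : (torsionSet p T).card = T) {Q : Finset (ZMod p)} (hQ : IsTorsionInvariant T Q)
    {ξ : ZMod p} (hξ : ξ ≠ 0) :
    (T * ‖expSum Q ξ‖) ^ 4 ≤ Q.card ^ 3 * (p * diffEnergy (torsionSet p T)) := by
  classical
  set S := torsionSet p T with hS
  have h1 : (T : ℂ) * expSum Q ξ = ∑ x ∈ Q, expSum S (x * ξ) := by
    simp only [expSum]
    rw [Finset.sum_comm, ← hcard, ← nsmul_eq_mul, eq_comm]
    refine Finset.sum_eq_card_nsmul fun g hg => ?_
    rw [hS, mem_torsionSet] at hg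
    have hg0 := ne_zero_of_pow_eq_one hT hg
    have hg' : g⁻¹ ^ T = 1 := by rw [inv_pow, hg, inv_one]
    refine Finset.sum_bij' (fun x _ => g * x) (fun x _ => g⁻¹ * x) (fun x hx => hQ.2 _ _ hg hx)
      (fun x hx => hQ.2 _ _ hg' hx) (fun x _ => inv_mul_cancel_left₀ hg0 x)
      (fun x _ => mul_inv_cancel_left₀ hg0 x) fun x _ => by rw [mul_assoc]
  have h2 : T * ‖expSum Q ξ‖ ≤ ∑ x ∈ Q, ‖expSum S (x * ξ)‖ := by
    have := norm_sum_le Q fun x => expSum S (x * ξ)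
    rwa [← h1, norm_mul, Complex.norm_natCast] at this
  calc (T * ‖expSum Q ξ‖) ^ 4 ≤ (∑ x ∈ Q, ‖expSum S (x * ξ)‖) ^ 4 := by gcongr
    _ ≤ Q.card ^ 3 * ∑ x ∈ Q, ‖expSum S (x * ξ)‖ ^ 4 :=
        sum_pow_four_le _ _
    _ = Q.card ^ 3 * ∑ y ∈ Q.image (· * ξ), ‖expSum S y‖ ^ 4 := by
        rw [Finset.sum_image]
        intro x _ y _ h
        exact mul_right_cancel₀ hξ h
    _ ≤ Q.card ^ 3 * ∑ y, ‖expSum S y‖ ^ 4 := by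
        gcongr
        exact Finset.subset_univ _
    _ = _ := by rw [sum_norm_pow_four_expSum]

theorem pairCount_le_of_expSum_le {p : ℕ} [Fact p.Prime] (P Q : Finset (ZMod p)) {M : ℝ}
    (hM : ∀ ξ, ξ ≠ 0 → ‖expSum Q ξ‖ ≤ M) :
    p * (pairCount P Q : ℝ) ≤ P.card ^ 2 * Q.card + M * (p * P.card) := by
  classical
  have hN : (pairCount P Q : ℂ) = ∑ q ∈ Q, (shiftCount P P q : ℂ) := by
    have h := sum_cast_shiftCount_mul (R := ℂ) P P (fun x => if x ∈ Q then 1 else 0)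
    simp only [mul_ite, mul_one, mul_zero, Finset.sum_ite_mem, Finset.univ_inter] at h
    rw [h, pairCount, Finset.card_filter, Finset.sum_product]
    push_cast
    rfl
  have hinv : (p : ℂ) * pairCount P Q =
      ∑ ξ, ((‖expSum P ξ‖ ^ 2 : ℝ) : ℂ) * (starRingEnd ℂ) (expSum Q ξ) := by
    simp only [norm_sq_expSum]
    simp only [expSum, map_sum, Finset.sum_mul_sum]
    rw [Finset.sum_comm]
    have h1 : ∀ x, ∑ ξ, ∑ q ∈ Q, (shiftCount P P x : ℂ) * ZMod.stdAddChar (x * ξ) *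
        (starRingEnd ℂ) (ZMod.stdAddChar (q * ξ)) =
        if x ∈ Q then (p : ℂ) * shiftCount P P x else 0 := by
      intro x
      rw [Finset.sum_comm]
      have h2 : ∀ q, ∑ ξ, (shiftCount P P x : ℂ) * ZMod.stdAddChar (x * ξ) *
          (starRingEnd ℂ) (ZMod.stdAddChar (q * ξ)) =
          if x = q then (p : ℂ) * shiftCount P P x else 0 := by
        intro q
        have h3 : ∀ ξ : ZMod p, (shiftCount P P x : ℂ) * ZMod.stdAddChar (x * ξ) *
            (starRingEnd ℂ) (ZMod.stdAddChar (q * ξ)) =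
            shiftCount P P x * ZMod.stdAddChar ((x - q) * ξ) := by
          intro ξ
          rw [← AddChar.map_neg_eq_conj, sub_mul, sub_eq_add_neg, AddChar.map_add_eq_mul]
          ring
        simp only [h3]
        rw [← Finset.mul_sum, sum_stdAddChar_mul]
        by_cases h : x = q
        · simp [h]; ring
        · rw [if_neg (sub_ne_zero.2 h), if_neg h, mul_zero]
      simp only [h2, Finset.sum_ite_eq]
    simp only [h1]
    rw [Finset.sum_ite_mem, Finset.univ_inter, hN, Finset.mul_sum]
  have hnorm : p * (pairCount P Q : ℝ) ≤ ∑ ξ, ‖expSum P ξ‖ ^ 2 * ‖expSum Q ξ‖ := by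
    have h1 := norm_sum_le Finset.univ
      fun ξ => ((‖expSum P ξ‖ ^ 2 : ℝ) : ℂ) * (starRingEnd ℂ) (expSum Q ξ)
    rw [← hinv, norm_mul, Complex.norm_natCast, Complex.norm_natCast] at h1
    refine h1.trans (le_of_eq (Finset.sum_congr rfl fun ξ _ => ?_))
    rw [norm_mul, Complex.norm_real, norm_pow, norm_norm, RCLike.norm_conj]
  refine hnorm.trans ?_
  rw [← Finset.add_sum_erase _ _ (Finset.mem_univ (0 : ZMod p))]
  refine add_le_add (le_of_eq ?_) ?_
  · simp [expSum]
  · have hM0 : 0 ≤ M := (norm_nonneg _).trans (hM 1 one_ne_zero)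
    calc _ ≤ ∑ ξ ∈ Finset.univ.erase 0, ‖expSum P ξ‖ ^ 2 * M :=
          Finset.sum_le_sum fun ξ hξ => by
            gcongr; exact hM ξ (Finset.ne_of_mem_erase hξ)
      _ ≤ ∑ ξ, ‖expSum P ξ‖ ^ 2 * M :=
          Finset.sum_le_sum_of_subset_of_nonneg (Finset.subset_univ _)
            fun ξ _ _ => by positivity
      _ = _ := by rw [← Finset.sum_mul, sum_norm_sq_expSum]; ring

/-! ### The multiplicative character sum -/

theorem sum_mulChar_shift_re_le {p : ℕ} [Fact p.Prime] {χ : MulChar (ZMod p) ℂ} (hχ : χ ≠ 1)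
    (u v : ZMod p) :
    (∑ x, χ (x + u) * (starRingEnd ℂ) (χ (x + v))).re ≤ if u = v then (p : ℝ) else 0 := by
  split_ifs with h
  · subst h
    rw [Complex.re_sum]
    calc _ ≤ ∑ x : ZMod p, (1 : ℝ) := by
          refine Finset.sum_le_sum fun x _ => ?_
          rw [Complex.mul_conj', ← Complex.ofReal_pow, Complex.ofReal_re]
          exact pow_le_one₀ (norm_nonneg _) (DirichletCharacter.norm_le_one χ _)
      _ = p := by simp [ZMod.card]
  · have hw : u - v ≠ 0 := sub_ne_zero.2 h
    have hw' : -(u - v) ≠ 0 := neg_ne_zero.2 hw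
    have hJ := jacobiSum_nontrivial_inv hχ
    have h1 : ∑ x, χ (x + u) * (starRingEnd ℂ) (χ (x + v)) = -1 := by
      have h2 : ∑ x, χ (x + u) * (starRingEnd ℂ) (χ (x + v)) =
          ∑ t, χ ((u - v) * t) * χ⁻¹ (-(u - v) * (1 - t)) := by
        rw [← Equiv.sum_comp ((Equiv.mulLeft₀ (u - v) hw).trans (Equiv.subRight u))]
        refine Finset.sum_congr rfl fun t _ => ?_
        rw [starRingEnd_apply, MulChar.star_apply']
        simp only [Equiv.trans_apply, Equiv.mulLeft₀_apply, Equiv.subRight_apply]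
        congr 2 <;> ring
      have h3 : χ (-1) * χ (-1) = 1 := by rw [← map_mul]; simp
      have h4 : χ (u - v) * χ⁻¹ (u - v) = 1 := by
        rw [← MulChar.mul_apply, mul_inv_cancel, MulChar.one_apply hw.isUnit]
      have h5 : χ⁻¹ (-1) = χ (-1) := by
        rw [MulChar.inv_apply', inv_neg_one]
      rw [h2]
      simp only [map_mul]
      have h6 : χ⁻¹ (-(u - v)) = χ⁻¹ (-1) * χ⁻¹ (u - v) := by rw [← map_mul, neg_one_mul]
      calc _ = χ (u - v) * χ⁻¹ (-(u - v)) * jacobiSum χ χ⁻¹ := by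
            rw [jacobiSum, Finset.mul_sum]
            exact Finset.sum_congr rfl fun t _ => by ring
        _ = -((χ (u - v) * χ⁻¹ (u - v)) * (χ (-1) * χ (-1))) := by
            rw [hJ, h6, h5]; ring
        _ = -1 := by rw [h3, h4, mul_one]
    rw [h1]; simp

/-- Dilating by the subgroup shows that the double sum has the same modulus at all `a g`,
`g ∈ S`; the mean square over all shifts is the energy of `S`. -/
theorem card_mul_norm_doubleSum_sq_le {p T : ℕ} [Fact p.Prime] (hT : 1 ≤ T)
    (hcard : (torsionSet p T).card = T) {χ : MulChar (ZMod p) ℂ} (hχ : χ ≠ 1) {a : ZMod p}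
    (ha : a ≠ 0) :
    T * ‖∑ l ∈ torsionSet p T, ∑ m ∈ torsionSet p T, χ (a + l + m)‖ ^ 2 ≤
      p * diffEnergy (torsionSet p T) := by
  classical
  set S := torsionSet p T with hS
  set F : ZMod p → ℂ := fun x => ∑ z ∈ S ×ˢ S, χ (x + (z.1 + z.2)) with hF
  have hFa : ∑ l ∈ S, ∑ m ∈ S, χ (a + l + m) = F a := by
    simp only [hF, Finset.sum_product, add_assoc]
  have hdil : ∀ g ∈ S, ‖F (g * a)‖ = ‖F a‖ := by
    intro g hg
    rw [hS, mem_torsionSet] at hg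
    have hg0 := ne_zero_of_pow_eq_one hT hg
    have hg' : g⁻¹ ^ T = 1 := by rw [inv_pow, hg, inv_one]
    have hinv := (isTorsionInvariant_torsionSet (p := p) hT).2
    have h1 : F (g * a) = χ g * F a := by
      simp only [hF, Finset.mul_sum, ← map_mul]
      refine (Finset.sum_bij' (fun z _ => (g * z.1, g * z.2)) (fun z _ => (g⁻¹ * z.1, g⁻¹ * z.2))
        ?_ ?_ ?_ ?_ ?_).symm
      · intro z hz
        rw [Finset.mem_product] at *
        exact ⟨hinv _ _ hg hz.1, hinv _ _ hg hz.2⟩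
      · intro z hz
        rw [Finset.mem_product] at *
        exact ⟨hinv _ _ hg' hz.1, hinv _ _ hg' hz.2⟩
      · intro z _; simp [hg0]
      · intro z _; simp [hg0]
      · intro z _; congr 1; ring
    have h2 : ‖χ g‖ = 1 := by
      have : ‖χ g‖ ^ T = 1 := by rw [← norm_pow, ← map_pow, hg, map_one, norm_one]
      exact (pow_eq_one_iff_of_nonneg (norm_nonneg _) (by omega)).1 this
    rw [h1, norm_mul, h2, one_mul]
  have hsum : T * ‖F a‖ ^ 2 ≤ ∑ x, ‖F x‖ ^ 2 := by
    calc T * ‖F a‖ ^ 2 = ∑ g ∈ S, ‖F (g * a)‖ ^ 2 := by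
          rw [Finset.sum_congr rfl fun g hg => by rw [hdil g hg], Finset.sum_const, hcard,
            nsmul_eq_mul]
      _ = ∑ x ∈ S.image (· * a), ‖F x‖ ^ 2 := by
          rw [Finset.sum_image]
          intro x _ y _ h
          exact mul_right_cancel₀ ha h
      _ ≤ _ := Finset.sum_le_sum_of_subset_of_nonneg (Finset.subset_univ _)
          fun _ _ _ => by positivity
  rw [hFa]
  refine hsum.trans ?_
  have hexp : ∑ x, ‖F x‖ ^ 2 = ∑ z ∈ S ×ˢ S, ∑ w ∈ S ×ˢ S,
      (∑ x, χ (x + (z.1 + z.2)) * (starRingEnd ℂ) (χ (x + (w.1 + w.2)))).re := by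
    have h1 : ∀ x, ‖F x‖ ^ 2 = ∑ z ∈ S ×ˢ S, ∑ w ∈ S ×ˢ S,
        (χ (x + (z.1 + z.2)) * (starRingEnd ℂ) (χ (x + (w.1 + w.2)))).re := by
      intro x
      have h2 : ((‖F x‖ ^ 2 : ℝ) : ℂ).re = (F x * (starRingEnd ℂ) (F x)).re := by
        rw [Complex.mul_conj', Complex.ofReal_pow]
      rw [Complex.ofReal_re] at h2
      rw [h2]
      simp only [hF, map_sum, Finset.sum_mul_sum, Complex.re_sum]
    simp only [h1, Complex.re_sum]
    rw [Finset.sum_comm]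
    exact Finset.sum_congr rfl fun z _ => Finset.sum_comm
  rw [hexp]
  calc _ ≤ ∑ z ∈ S ×ˢ S, ∑ w ∈ S ×ˢ S, if z.1 + z.2 = w.1 + w.2 then (p : ℝ) else 0 :=
        Finset.sum_le_sum fun z _ => Finset.sum_le_sum fun w _ => sum_mulChar_shift_re_le hχ _ _
    _ = p * diffEnergy S := by
        have h1 : diffEnergy S = ∑ l ∈ S, ∑ l' ∈ S, shiftCount S S (l - l') := by
          rw [diffEnergy]
          simp only [sq]
          rw [sum_shiftCount_mul, Finset.sum_comm]
        rw [h1, Finset.sum_product]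
        push_cast
        rw [Finset.mul_sum]
        refine Finset.sum_congr rfl fun l _ => ?_
        rw [Finset.sum_comm, Finset.sum_product, Finset.mul_sum]
        refine Finset.sum_congr rfl fun l' _ => ?_
        rw [Finset.sum_comm, shiftCount, Finset.card_filter]
        push_cast
        rw [Finset.mul_sum]
        refine Finset.sum_congr rfl fun m _ => ?_
        rw [mul_ite, mul_one, mul_zero]
        have h2 : ∀ m', (l + m = l' + m') ↔ (l - l' + m = m') := by
          intro m'
          constructor
          · intro h; linear_combination h
          · intro h; linear_combination h
        simp only [h2, Finset.sum_ite_eq]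

/-- A subgroup of order `T` of the units consists of all solutions of `x ^ T = 1`, since there are
at most `T` of these. -/
theorem doubleSubgroupSum_eq {p : ℕ} [Fact p.Prime] (χ : MulChar (ZMod p) ℂ) (a : ZMod p)
    (G : Subgroup (ZMod p)ˣ) :
    (torsionSet p (Nat.card G)).card = Nat.card G ∧ doubleSubgroupSum p χ a G = ∑ l ∈ torsionSet p (Nat.card G),
      ∑ m ∈ torsionSet p (Nat.card G), χ (a + l + m) := by
  let _ : DecidablePred (· ∈ G) := fun _ => Classical.propDecidable _
  have hT : 0 < Nat.card G := Nat.card_pos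
  set T := Nat.card G with hTdef
  set e : G ↪ ZMod p := ⟨fun g => ((g : (ZMod p)ˣ) : ZMod p),
    fun g h hgh => Subtype.ext (Units.ext hgh)⟩ with he
  have hsub : Finset.univ.map e ⊆ torsionSet p T := by
    intro x hx
    obtain ⟨g, -, rfl⟩ := Finset.mem_map.1 hx
    rw [mem_torsionSet]
    have : g ^ T = 1 := pow_card_eq_one'
    have h2 := congrArg (fun g : G => ((g : (ZMod p)ˣ) : ZMod p)) this
    change ((g : (ZMod p)ˣ) : ZMod p) ^ T = 1
    simpa using h2
  have hle : (torsionSet p T).card ≤ T := by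
    have : torsionSet p T ⊆ Polynomial.nthRootsFinset T (1 : ZMod p) := fun x hx => by
      rw [Polynomial.mem_nthRootsFinset hT]; exact mem_torsionSet.1 hx
    refine (Finset.card_le_card this).trans ?_
    rw [Polynomial.nthRootsFinset]
    exact (@Multiset.toFinset_card_le _ (Classical.decEq _) _).trans (Polynomial.card_nthRoots _ _)
  have hmap : (Finset.univ.map e).card = T := by
    rw [Finset.card_map, Finset.card_univ, hTdef, Nat.card_eq_fintype_card]
  have heq : Finset.univ.map e = torsionSet p T :=
    Finset.eq_of_subset_of_card_le hsub (by rw [hmap]; exact hle)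
  refine ⟨by rw [← heq, hmap], ?_⟩
  rw [← heq, doubleSubgroupSum]
  simp only [Finset.sum_map]
  rfl

/-! ### Additive energy of subgroups -/

theorem sum_shiftCount_pow_level_le {p : ℕ} [Fact p.Prime] (S : Finset (ZMod p)) (k n : ℕ) :
    (dyadicLevel S k).card * (2 ^ k) ^ n ≤ ∑ x, shiftCount S S x ^ n := by
  rw [← smul_eq_mul]
  refine (Finset.card_nsmul_le_sum _ (fun x => shiftCount S S x ^ n) _ fun x hx => ?_).trans
    (Finset.sum_le_sum_of_subset (Finset.subset_univ _))
  exact Nat.pow_le_pow_left (Finset.mem_filter.1 hx).2.2.1 n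

theorem card_dyadicLevel_le {p T : ℕ} [Fact p.Prime] (hcard : (torsionSet p T).card = T) (k : ℕ) :
    (dyadicLevel (torsionSet p T) k).card ≤ T ^ 2 := by
  have h := sum_shiftCount_pow_level_le (torsionSet p T) k 1
  simp only [pow_one, sum_shiftCount, hcard] at h
  rw [sq]
  exact (Nat.le_mul_of_pos_right _ (by positivity)).trans h

/-- Unless the zero difference dominates, one dyadic level carries the energy up to a factor `L`. -/
theorem exists_dyadicLevel_diffEnergy_le {p T L : ℕ} [Fact p.Prime]
    (hcard : (torsionSet p T).card = T) (hL : T < 2 ^ L) (hL1 : 0 < L) :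
    diffEnergy (torsionSet p T) ≤ 2 * T ^ 2 ∨ ∃ k, diffEnergy (torsionSet p T) ≤
      8 * L * ((dyadicLevel (torsionSet p T) k).card * (2 ^ k) ^ 2) := by
  classical
  set S := torsionSet p T with hS
  obtain ⟨k, -, hk⟩ := Finset.exists_max_image (Finset.range L)
    (fun k => (dyadicLevel S k).card * (2 ^ k) ^ 2) ⟨0, Finset.mem_range.2 hL1⟩
  have h1 : diffEnergy S ≤ T ^ 2 + L * (4 * ((dyadicLevel S k).card * (2 ^ k) ^ 2)) := by
    rw [diffEnergy, ← Finset.add_sum_erase _ _ (Finset.mem_univ (0 : ZMod p)), shiftCount_zero,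
      hcard]
    refine Nat.add_le_add_left ?_ _
    refine (sum_le_sum_dyadic _ (shiftCount S S) _ L (fun x _ =>
      (shiftCount_le_left S S x).trans_lt (hcard.trans_lt hL)) (fun x _ h => by rw [h]; rfl)).trans ?_
    conv_rhs => rw [← Finset.card_range L, ← smul_eq_mul]
    refine Finset.sum_le_card_nsmul _ _ _ fun j hj => ?_
    calc _ ≤ ∑ x ∈ dyadicLevel S j, (2 ^ (j + 1)) ^ 2 := by
          refine (Finset.sum_le_sum fun x hx =>
            Nat.pow_le_pow_left (Finset.mem_filter.1 hx).2.2.le 2).trans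
              (Finset.sum_le_sum_of_subset fun x hx => ?_)
          simp only [Finset.mem_filter, Finset.mem_erase, Finset.mem_univ, dyadicLevel] at *
          exact ⟨trivial, hx.1.1, hx.2⟩
      _ = 4 * ((dyadicLevel S j).card * (2 ^ j) ^ 2) := by
          rw [Finset.sum_const, smul_eq_mul]; ring
      _ ≤ _ := Nat.mul_le_mul_left _ (hk j hj)
  rcases le_or_gt (diffEnergy S) (2 * T ^ 2) with h | h
  · exact Or.inl h
  · right
    refine ⟨k, ?_⟩
    have h2 : L * (4 * ((dyadicLevel S k).card * (2 ^ k) ^ 2)) * 2 =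
      8 * L * ((dyadicLevel S k).card * (2 ^ k) ^ 2) := by ring
    omega

/-- Here `T ≤ p ^ (2 / 3)` enters: it makes `B = min T ⌊p / T⌋` at least half of `T ^ (1 / 2)`. -/
theorem sum_shiftCount_cube_self_le {p T L : ℕ} [Fact p.Prime] (hT : 1 ≤ T)
    (hTp : T ^ 3 ≤ p ^ 2) (hcard : (torsionSet p T).card = T) (hL : T < 2 ^ L) :
    ∑ x, shiftCount (torsionSet p T) (torsionSet p T) x ^ 3 ≤ 2 ^ 18 * L * T ^ 3 := by
  have hp : 0 < p := (Fact.out : p.Prime).pos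
  have hTlep : T ≤ p := by
    by_contra! h
    have h1 : p ^ 3 < T ^ 3 := Nat.pow_lt_pow_left h (by norm_num)
    have h2 : p ^ 2 ≤ p ^ 3 := Nat.pow_le_pow_right hp (by norm_num)
    omega
  have hdiv : 1 ≤ p / T := (Nat.one_le_div_iff hT).2 hTlep
  have hB : T ≤ 4 * (min T (p / T)) ^ 2 := by
    rcases le_total T (p / T) with h | h
    · rw [min_eq_left h]; nlinarith
    · rw [min_eq_right h]
      have h1 : p < T * (p / T + 1) := Nat.lt_mul_div_succ p hT
      have h2 : p ≤ T * (2 * (p / T)) := h1.le.trans (Nat.mul_le_mul_left _ (by omega))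
      have h3 : T ^ 2 * T ≤ T ^ 2 * (4 * (p / T) ^ 2) := by
        calc T ^ 2 * T = T ^ 3 := by ring
          _ ≤ p ^ 2 := hTp
          _ ≤ (T * (2 * (p / T))) ^ 2 := Nat.pow_le_pow_left h2 2
          _ = _ := by ring
      exact Nat.le_of_mul_le_mul_left h3 (by positivity)
  have h := sum_shiftCount_cube_le (le_min hT hdiv) (min_le_left _ _)
    ((Nat.mul_le_mul_left _ (min_le_right _ _)).trans (Nat.mul_div_le p T)) hcard hL
    (isTorsionInvariant_torsionSet hT) (by rw [hcard]; exact hB)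
  rw [hcard] at h
  refine h.trans ?_
  calc 256001 * L * T * T ^ 2 = 256001 * L * T ^ 3 := by ring
    _ ≤ _ := by gcongr; norm_num

/-- The alternative reflects whether the zero frequency dominates the Fourier expansion of
`pairCount P Q`. -/
theorem pairCount_le_or {p T : ℕ} [Fact p.Prime] (hT : 1 ≤ T)
    (hcard : (torsionSet p T).card = T) (P : Finset (ZMod p)) {Q : Finset (ZMod p)}
    (hQ : IsTorsionInvariant T Q) :
    p * pairCount P Q ≤ 2 * P.card ^ 2 * Q.card ∨
    (T * pairCount P Q) ^ 4 ≤ 16 * P.card ^ 4 * Q.card ^ 3 * p * diffEnergy (torsionSet p T) := by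
  have hp : 0 < p := (Fact.out : p.Prime).pos
  set E := diffEnergy (torsionSet p T) with hE
  have hT0 : (0 : ℝ) < T := by exact_mod_cast hT
  obtain ⟨μ, hμ0, hμ⟩ : ∃ μ : ℝ, 0 ≤ μ ∧ μ ^ 4 = Q.card ^ 3 * (p * E) := by
    refine ⟨((Q.card : ℝ) ^ 3 * (p * E)) ^ ((4 : ℕ)⁻¹ : ℝ), by positivity, ?_⟩
    exact Real.rpow_inv_natCast_pow (by positivity) (by norm_num)
  have hM : ∀ ξ, ξ ≠ 0 → ‖expSum Q ξ‖ ≤ μ / T := by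
    intro ξ hξ
    rw [le_div_iff₀ hT0, mul_comm]
    refine le_of_pow_le_pow_left₀ (n := 4) (by norm_num) hμ0 ?_
    rw [hμ]
    exact norm_expSum_pow_four_le hT hcard hQ hξ
  have h := pairCount_le_of_expSum_le P Q hM
  rcases le_or_gt (μ / T * (p * P.card) : ℝ) (P.card ^ 2 * Q.card) with h1 | h1
  · left
    have : (p * pairCount P Q : ℝ) ≤ 2 * P.card ^ 2 * Q.card := by linarith
    exact_mod_cast this
  · right
    have h2 : (T * pairCount P Q : ℝ) ≤ 2 * μ * P.card := by
      have hp0 : (0 : ℝ) < p := by exact_mod_cast hp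
      have h3 : (p : ℝ) * pairCount P Q ≤ p * (2 * (μ / T) * P.card) := by linarith
      have h4 := le_of_mul_le_mul_left h3 hp0
      calc (T * pairCount P Q : ℝ) ≤ T * (2 * (μ / T) * P.card) := by gcongr
        _ = 2 * μ * P.card := by field_simp
    have h5 : ((T * pairCount P Q : ℝ)) ^ 4 ≤ 16 * P.card ^ 4 * Q.card ^ 3 * p * E := by
      calc ((T * pairCount P Q : ℝ)) ^ 4 ≤ (2 * μ * P.card) ^ 4 := by gcongr
        _ = 16 * P.card ^ 4 * μ ^ 4 := by ring
        _ = _ := by rw [hμ]; ring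
    exact_mod_cast h5

/-- Apart from two degenerate cases, there is a dyadic level `j` carrying the energy and a dyadic
level `k` for which `exists_level_pairCount` holds; third moments have been bounded. -/
theorem diffEnergy_cases {p T L : ℕ} [Fact p.Prime] (hT : 1 ≤ T) (hTp : T ^ 3 ≤ p ^ 2)
    (hcard : (torsionSet p T).card = T) (hL : T < 2 ^ L) :
    diffEnergy (torsionSet p T) ≤ 2 * T ^ 2 ∨
    diffEnergy (torsionSet p T) ^ 3 ≤ 2 ^ 25 * L ^ 3 * T ^ 7 ∨
    ∃ j k, diffEnergy (torsionSet p T) ≤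
        8 * L * ((dyadicLevel (torsionSet p T) j).card * (2 ^ j) ^ 2) ∧
      ((dyadicLevel (torsionSet p T) j).card * 2 ^ j) ^ 4 * diffEnergy (torsionSet p T) ^ 2 ≤
        2 ^ 22 * L ^ 3 * T ^ 9 * (2 ^ k) ^ 2 * pairCount (dyadicLevel (torsionSet p T) j)
          (dyadicLevel (torsionSet p T) k) := by
  have hL1 : 0 < L := pos_of_lt_two_pow hT hL
  have hE3 := sum_shiftCount_cube_self_le hT hTp hcard hL
  rcases exists_dyadicLevel_diffEnergy_le hcard hL hL1 with h | ⟨j, hj⟩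
  · exact Or.inl h
  right
  have hPinv := isTorsionInvariant_dyadicLevel (p := p) hT j
  rcases exists_level_pairCount hT hcard hL hPinv
    (fun x hx => (Finset.mem_filter.1 hx).2.2.1) with h | ⟨k, hk⟩
  · left
    have hP3 := (sum_shiftCount_pow_level_le (torsionSet p T) j 3).trans hE3
    set E := diffEnergy (torsionSet p T)
    set P := (dyadicLevel (torsionSet p T) j).card
    calc E ^ 3 = E ^ 2 * E := by ring
      _ ≤ (8 * L * (P * (2 ^ j) ^ 2)) ^ 2 * E := by gcongr
      _ = 64 * L ^ 2 * (P * (2 ^ j) ^ 3) * (P * 2 ^ j * E) := by ring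
      _ ≤ 64 * L ^ 2 * (2 ^ 18 * L * T ^ 3) * (2 * T ^ 4) := by gcongr
      _ = _ := by ring
  · right
    refine ⟨j, k, hj, hk.trans ?_⟩
    calc _ ≤ 16 * T ^ 6 * L ^ 2 * (2 ^ k) ^ 2 * (pairCount (dyadicLevel (torsionSet p T) j)
          (dyadicLevel (torsionSet p T) k) * (2 ^ 18 * L * T ^ 3)) := by gcongr
      _ = _ := by ring

/-- The second and third moments bound `v ^ 8 * Q ^ 3` for a level of size `Q` and height `v`. The
two bounds for `Q` agree when `v` is about `T ^ 3 / E`. -/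
theorem level_energy_algebra {E T L Q v : ℕ} (h2 : Q * v ^ 2 ≤ E)
    (h3 : Q * v ^ 3 ≤ 2 ^ 18 * L * T ^ 3) : v ^ 8 * Q ^ 3 ≤ 2 ^ 36 * L ^ 2 * T ^ 6 * E := by
  calc v ^ 8 * Q ^ 3 = (Q * v ^ 3) ^ 2 * (Q * v ^ 2) := by ring
    _ ≤ (2 ^ 18 * L * T ^ 3) ^ 2 * E := by gcongr
    _ = _ := by ring

set_option exponentiation.threshold 2000 in
/-- For a subgroup of order `T ≤ p ^ (1 / 2)` the additive energy is at most `T ^ (32 / 13)`, up to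
logarithms. -/
theorem diffEnergy_pow_le_of_sq_le {p T L : ℕ} [Fact p.Prime] (hT : 1 ≤ T) (hTp : T ^ 2 ≤ p)
    (hcard : (torsionSet p T).card = T) (hL : T < 2 ^ L) :
    diffEnergy (torsionSet p T) ^ 26 ≤ (2 ^ 20 * L ^ 2) ^ 26 * T ^ 64 := by
  have hL1 : 1 ≤ L := pos_of_lt_two_pow hT hL
  have hTp3 : T ^ 3 ≤ p ^ 2 := by
    calc T ^ 3 ≤ T ^ 4 := Nat.pow_le_pow_right hT (by norm_num)
      _ = (T ^ 2) ^ 2 := by ring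
      _ ≤ p ^ 2 := by gcongr
  have hE3 := sum_shiftCount_cube_self_le hT hTp3 hcard hL
  rcases diffEnergy_cases hT hTp3 hcard hL with h | h | ⟨j, k, h1, h2⟩
  · calc _ ≤ (2 * T ^ 2) ^ 26 := by gcongr
      _ = 2 ^ 26 * T ^ 52 := by ring
      _ ≤ (2 ^ 20 * L ^ 2) ^ 26 * T ^ 64 := by
          have hM : 2 ≤ 2 ^ 20 * L ^ 2 := by
            calc 2 ≤ 2 ^ 20 * 1 ^ 2 := by norm_num
              _ ≤ _ := by gcongr
          gcongr
          norm_num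
  · refine le_of_pow_le_pow_left₀ (n := 3) (by norm_num) (Nat.zero_le _) ?_
    calc _ = (diffEnergy (torsionSet p T) ^ 3) ^ 26 := by ring
      _ ≤ (2 ^ 25 * L ^ 3 * T ^ 7) ^ 26 := by gcongr
      _ = 2 ^ 650 * L ^ 78 * T ^ 182 := by ring
      _ ≤ 2 ^ 1560 * L ^ 156 * T ^ 192 := by gcongr <;> first | assumption | norm_num
      _ = _ := by ring
  · have hP3 := (sum_shiftCount_pow_level_le (torsionSet p T) j 3).trans hE3
    have hQ2 := sum_shiftCount_pow_level_le (torsionSet p T) k 2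
    have hQ3 := (sum_shiftCount_pow_level_le (torsionSet p T) k 3).trans hE3
    have hlev := level_energy_algebra hQ2 hQ3
    have hcb : ∀ i, (dyadicLevel (torsionSet p T) i).card ≤ 4 * T ^ 2 := fun i =>
      (card_dyadicLevel_le hcard i).trans (by omega)
    have h6 := pow_four_mul_pairCount_le hT le_rfl (by rw [← sq]; exact hTp) hcard hL
      (isTorsionInvariant_dyadicLevel hT j) (hcb j) (isTorsionInvariant_dyadicLevel hT k) (hcb k)
      (Δ := 2 ^ j) (fun x hx => (Finset.mem_filter.1 hx).2.2.1)
    change _ ≤ 2 ^ 36 * L ^ 2 * T ^ 6 * diffEnergy (torsionSet p T) at hlev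
    set E := diffEnergy (torsionSet p T)
    set N := pairCount (dyadicLevel (torsionSet p T) j) (dyadicLevel (torsionSet p T) k)
    set P := (dyadicLevel (torsionSet p T) j).card
    set Q := (dyadicLevel (torsionSet p T) k).card
    set u := 2 ^ j
    set v := 2 ^ k
    clear_value E N P Q u v
    rcases Nat.eq_zero_or_pos E with hE0 | hE0
    · rw [hE0]; simp
    have hP0 : 0 < P := by
      rcases Nat.eq_zero_or_pos P with h | h
      · subst h; simp at h1; omega
      · exact h
    -- The fourth power of `h2` removes `N` through `h6`, then `hlev` removes `Q` and `v`. In `h9` the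
    -- powers of `P` and `u` are written in terms of `P * u ^ 2` and `P * u ^ 3`.
    have h7 : P ^ 3 * (P ^ 13 * u ^ 20 * E ^ 8) ≤
        P ^ 3 * (2 ^ 160 * L ^ 16 * T ^ 46 * E) := by
      calc P ^ 3 * (P ^ 13 * u ^ 20 * E ^ 8) = ((P * u) ^ 4 * E ^ 2) ^ 4 * u ^ 4 := by ring
        _ ≤ (2 ^ 22 * L ^ 3 * T ^ 9 * v ^ 2 * N) ^ 4 * u ^ 4 := by gcongr
        _ = 2 ^ 88 * L ^ 12 * T ^ 36 * v ^ 8 * (u * N) ^ 4 := by ring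
        _ ≤ 2 ^ 88 * L ^ 12 * T ^ 36 * v ^ 8 * ((2 ^ 18) ^ 2 * L ^ 2 * T ^ 4 * P ^ 3 * Q ^ 3) := by
            gcongr
            refine h6.trans ?_
            gcongr
            norm_num
        _ = 2 ^ 124 * L ^ 14 * T ^ 40 * P ^ 3 * (v ^ 8 * Q ^ 3) := by ring
        _ ≤ 2 ^ 124 * L ^ 14 * T ^ 40 * P ^ 3 * (2 ^ 36 * L ^ 2 * T ^ 6 * E) := by gcongr
        _ = _ := by ring
    have h8 := Nat.le_of_mul_le_mul_left h7 (by positivity)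
    have h9 : E * E ^ 26 ≤ E * (2 ^ 325 * L ^ 41 * T ^ 64) := by
      calc E * E ^ 26 = E ^ 19 * E ^ 8 := by ring
        _ ≤ (8 * L * (P * u ^ 2)) ^ 19 * E ^ 8 := by gcongr
        _ = 2 ^ 57 * L ^ 19 * ((P ^ 13 * u ^ 20 * E ^ 8) * (P * u ^ 3) ^ 6) := by ring
        _ ≤ 2 ^ 57 * L ^ 19 * ((2 ^ 160 * L ^ 16 * T ^ 46 * E) * (2 ^ 18 * L * T ^ 3) ^ 6) := by
            gcongr
        _ = E * (2 ^ 325 * L ^ 41 * T ^ 64) := by ring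
    calc E ^ 26 ≤ 2 ^ 325 * L ^ 41 * T ^ 64 := Nat.le_of_mul_le_mul_left h9 hE0
      _ ≤ 2 ^ 520 * L ^ 52 * T ^ 64 := by gcongr <;> first | assumption | norm_num
      _ = _ := by ring

set_option exponentiation.threshold 2000 in
/-- For a subgroup of order `T ≤ p ^ (2 / 3)` the additive energy is at most
`max (T ^ 3 p ^ (-1 / 3)) (T ^ (31 / 13) p ^ (1 / 26))`, up to logarithms. -/
theorem diffEnergy_pow_le {p T L : ℕ} [Fact p.Prime] (hT : 1 ≤ T) (hTp : T ^ 3 ≤ p ^ 2)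
    (hcard : (torsionSet p T).card = T) (hL : T < 2 ^ L) :
    diffEnergy (torsionSet p T) ^ 3 * p ≤ (2 ^ 20 * L ^ 2) ^ 3 * T ^ 9 ∨
    diffEnergy (torsionSet p T) ^ 26 ≤ (2 ^ 20 * L ^ 2) ^ 26 * (T ^ 62 * p) := by
  have hp : 1 ≤ p := (Fact.out : p.Prime).pos
  have hL1 : 1 ≤ L := pos_of_lt_two_pow hT hL
  have hE3 := sum_shiftCount_cube_self_le hT hTp hcard hL
  rcases diffEnergy_cases hT hTp hcard hL with h | h | ⟨j, k, h1, h2⟩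
  · right
    calc _ ≤ (2 * T ^ 2) ^ 26 := by gcongr
      _ = 2 ^ 26 * (T ^ 52 * 1) := by ring
      _ ≤ (2 ^ 20 * L ^ 2) ^ 26 * (T ^ 62 * p) := by
          have hM : 2 ≤ 2 ^ 20 * L ^ 2 := by
            calc 2 ≤ 2 ^ 20 * 1 ^ 2 := by norm_num
              _ ≤ _ := by gcongr
          gcongr
          norm_num
  · right
    refine le_of_pow_le_pow_left₀ (n := 3) (by norm_num) (Nat.zero_le _) ?_
    calc _ = (diffEnergy (torsionSet p T) ^ 3) ^ 26 := by ring
      _ ≤ (2 ^ 25 * L ^ 3 * T ^ 7) ^ 26 := by gcongr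
      _ = 2 ^ 650 * L ^ 78 * T ^ 182 * 1 ^ 3 := by ring
      _ ≤ 2 ^ 1560 * L ^ 156 * T ^ 186 * p ^ 3 := by gcongr <;> first | assumption | norm_num
      _ = _ := by ring
  · have hP3 := (sum_shiftCount_pow_level_le (torsionSet p T) j 3).trans hE3
    have hQ2 := sum_shiftCount_pow_level_le (torsionSet p T) k 2
    have hQ3 := (sum_shiftCount_pow_level_le (torsionSet p T) k 3).trans hE3
    have hlev := level_energy_algebra hQ2 hQ3
    have h6 := pairCount_le_or hT hcard (dyadicLevel (torsionSet p T) j)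
      (isTorsionInvariant_dyadicLevel hT k)
    change _ ≤ 2 ^ 36 * L ^ 2 * T ^ 6 * diffEnergy (torsionSet p T) at hlev
    change _ ≤ diffEnergy (torsionSet p T) at hQ2
    set E := diffEnergy (torsionSet p T)
    set N := pairCount (dyadicLevel (torsionSet p T) j) (dyadicLevel (torsionSet p T) k)
    set P := (dyadicLevel (torsionSet p T) j).card
    set Q := (dyadicLevel (torsionSet p T) k).card
    set u := 2 ^ j
    set v := 2 ^ k
    clear_value E N P Q u v
    rcases Nat.eq_zero_or_pos E with hE0 | hE0
    · left; rw [hE0]; simp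
    have hP0 : 0 < P := by
      rcases Nat.eq_zero_or_pos P with h | h
      · subst h; simp at h1; omega
      · exact h
    rcases h6 with h6 | h6
    · left
      have h7 : (P ^ 2 * E) * (P ^ 2 * u ^ 4 * (E * p)) ≤
          (P ^ 2 * E) * (2 ^ 23 * L ^ 3 * T ^ 9) := by
        calc (P ^ 2 * E) * (P ^ 2 * u ^ 4 * (E * p)) = ((P * u) ^ 4 * E ^ 2) * p := by ring
          _ ≤ (2 ^ 22 * L ^ 3 * T ^ 9 * v ^ 2 * N) * p := by gcongr
          _ = 2 ^ 22 * L ^ 3 * T ^ 9 * v ^ 2 * (p * N) := by ring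
          _ ≤ 2 ^ 22 * L ^ 3 * T ^ 9 * v ^ 2 * (2 * P ^ 2 * Q) := by gcongr
          _ = 2 ^ 23 * L ^ 3 * T ^ 9 * P ^ 2 * (Q * v ^ 2) := by ring
          _ ≤ 2 ^ 23 * L ^ 3 * T ^ 9 * P ^ 2 * E := by gcongr
          _ = _ := by ring
      have h8 := Nat.le_of_mul_le_mul_left h7 (by positivity)
      calc E ^ 3 * p = E ^ 2 * (E * p) := by ring
        _ ≤ (8 * L * (P * u ^ 2)) ^ 2 * (E * p) := by gcongr
        _ = 64 * L ^ 2 * (P ^ 2 * u ^ 4 * (E * p)) := by ring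
        _ ≤ 64 * L ^ 2 * (2 ^ 23 * L ^ 3 * T ^ 9) := by gcongr
        _ = 2 ^ 29 * L ^ 5 * T ^ 9 := by ring
        _ ≤ 2 ^ 60 * L ^ 6 * T ^ 9 := by gcongr <;> first | assumption | norm_num
        _ = _ := by ring
    · right
      have h7 : (P ^ 4 * T ^ 4 * E ^ 2) * (P ^ 12 * u ^ 16 * E ^ 6) ≤
          (P ^ 4 * T ^ 4 * E ^ 2) * (2 ^ 128 * L ^ 14 * T ^ 38 * p) := by
        calc (P ^ 4 * T ^ 4 * E ^ 2) * (P ^ 12 * u ^ 16 * E ^ 6)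
            = ((P * u) ^ 4 * E ^ 2) ^ 4 * T ^ 4 := by ring
          _ ≤ (2 ^ 22 * L ^ 3 * T ^ 9 * v ^ 2 * N) ^ 4 * T ^ 4 := by gcongr
          _ = 2 ^ 88 * L ^ 12 * T ^ 36 * v ^ 8 * (T * N) ^ 4 := by ring
          _ ≤ 2 ^ 88 * L ^ 12 * T ^ 36 * v ^ 8 * (16 * P ^ 4 * Q ^ 3 * p * E) := by gcongr
          _ = 2 ^ 92 * L ^ 12 * T ^ 36 * P ^ 4 * p * E * (v ^ 8 * Q ^ 3) := by ring
          _ ≤ 2 ^ 92 * L ^ 12 * T ^ 36 * P ^ 4 * p * E * (2 ^ 36 * L ^ 2 * T ^ 6 * E) := by gcongr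
          _ = _ := by ring
      have h8 := Nat.le_of_mul_le_mul_left h7 (by positivity)
      calc E ^ 26 = E ^ 20 * E ^ 6 := by ring
        _ ≤ (8 * L * (P * u ^ 2)) ^ 20 * E ^ 6 := by gcongr
        _ = 2 ^ 60 * L ^ 20 * ((P ^ 12 * u ^ 16 * E ^ 6) * (P * u ^ 3) ^ 8) := by ring
        _ ≤ 2 ^ 60 * L ^ 20 * ((2 ^ 128 * L ^ 14 * T ^ 38 * p) * (2 ^ 18 * L * T ^ 3) ^ 8) := by
            gcongr
        _ = 2 ^ 332 * L ^ 42 * (T ^ 62 * p) := by ring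
        _ ≤ 2 ^ 520 * L ^ 52 * (T ^ 62 * p) := by gcongr <;> first | assumption | norm_num
        _ = _ := by ring

/-! ### The loss in the exponent -/

/-- The factor, a square of a logarithm, that is lost in the energy bounds. -/
noncomputable def logLoss (x : ℝ) : ℝ := 2 ^ 20 * (1 + 2 * Real.log x) ^ 2

/-- The function `δ` with `p ^ δ(p) = logLoss p`. -/
noncomputable def lossExponent (n : ℕ) : ℝ := Real.log (logLoss n) / Real.log n

theorem one_le_logLoss {x : ℝ} (hx : 1 ≤ x) : 1 ≤ logLoss x := by
  have := Real.log_nonneg hx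
  rw [logLoss]
  nlinarith

theorem rpow_lossExponent {p : ℕ} (hp : 2 ≤ p) : (p : ℝ) ^ lossExponent p = logLoss p := by
  have hp' : (1 : ℝ) < p := by exact_mod_cast hp
  have hs : Real.log p ≠ 0 := (Real.log_pos hp').ne'
  rw [Real.rpow_def_of_pos (by linarith), lossExponent, mul_div_cancel₀ _ hs, Real.exp_log]
  linarith [one_le_logLoss hp'.le]

theorem tendsto_lossExponent : Tendsto lossExponent atTop (𝓝 0) := by
  have h1 : Tendsto (fun y : ℝ => 1 + 2 * y) atTop atTop :=
    tendsto_atTop_add_const_left _ _ (tendsto_id.const_mul_atTop (by norm_num))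
  have h2 : Tendsto (fun y : ℝ => Real.log (1 + 2 * y) / (1 + 2 * y)) atTop (𝓝 0) :=
    (Real.isLittleO_log_id_atTop.tendsto_div_nhds_zero).comp h1
  have hinv : Tendsto (fun y : ℝ => y⁻¹) atTop (𝓝 0) := tendsto_inv_atTop_zero
  have h3 : Tendsto (fun y : ℝ => Real.log (2 ^ 20) * y⁻¹ +
      2 * (Real.log (1 + 2 * y) / (1 + 2 * y)) * (y⁻¹ + 2)) atTop (𝓝 0) := by
    have := (hinv.const_mul (Real.log (2 ^ 20))).add
      ((h2.const_mul 2).mul (hinv.add_const 2))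
    simpa using this
  have h4 : Tendsto (fun y : ℝ => Real.log (2 ^ 20 * (1 + 2 * y) ^ 2) / y) atTop (𝓝 0) := by
    refine h3.congr' ?_
    filter_upwards [eventually_gt_atTop 0] with y hy
    rw [Real.log_mul (by norm_num) (by positivity), Real.log_pow (1 + 2 * y) 2]
    have : (1 + 2 * y) ≠ 0 := by positivity
    field_simp
    push_cast
    ring
  exact h4.comp (Real.tendsto_log_atTop.comp tendsto_natCast_atTop_atTop)

theorem natLog_add_one_le {p : ℕ} (hp : 1 ≤ p) :
    ((Nat.log 2 p + 1 : ℕ) : ℝ) ≤ 1 + 2 * Real.log p := by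
  have h1 : (2 : ℝ) ^ Nat.log 2 p ≤ p := by
    exact_mod_cast Nat.pow_log_le_self 2 (by omega)
  have h2 := Real.log_le_log (by positivity) h1
  rw [Real.log_pow] at h2
  have h3 := Real.log_two_gt_d9
  have h4 : (0 : ℝ) ≤ Nat.log 2 p := Nat.cast_nonneg _
  push_cast
  nlinarith

/-! ### Bounds in terms of real exponents -/

theorem natCast_rpow_eq {n : ℕ} (hn : 1 ≤ n) (x : ℝ) :
    (n : ℝ) ^ x = Real.exp (x * Real.log n) := by
  rw [Real.rpow_def_of_pos (by exact_mod_cast hn), mul_comm]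

theorem le_rpow_iff_log {m n : ℕ} (hm : 1 ≤ m) (hn : 1 ≤ n) (x : ℝ) :
    (m : ℝ) ≤ (n : ℝ) ^ x ↔ Real.log m ≤ x * Real.log n := by
  rw [natCast_rpow_eq hn, Real.log_le_iff_le_exp (by exact_mod_cast hm)]

theorem doubleSubgroupBound_eq {p T : ℕ} (hp : 1 ≤ p) (hT : 1 ≤ T) (e : ℝ) :
    doubleSubgroupBound p T e =
      if Real.log T ≤ 1 / 2 * Real.log p then
        Real.exp (19 / 26 * Real.log T + (1 / 2 + e) * Real.log p)
      else if Real.log T ≤ 29 / 48 * Real.log p then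
        Real.exp (9 / 13 * Real.log T + (27 / 52 + e) * Real.log p)
      else Real.exp (Real.log T + (1 / 3 + e) * Real.log p) := by
  have hT0 : (0 : ℝ) < T := by exact_mod_cast hT
  simp only [doubleSubgroupBound, le_rpow_iff_log hT hp]
  simp only [Real.exp_add, natCast_rpow_eq hp,
    natCast_rpow_eq hT, Real.exp_log hT0]

theorem le_of_mul_sq_le {T p E M X Y B : ℝ} (hT : 0 < T) (hp : 0 ≤ p) (hM : 1 ≤ M)
    (hB : 0 ≤ B) (h1 : T * X ^ 2 ≤ p * E) (h2 : E ≤ M * Y) (h3 : p * Y ≤ T * B ^ 2) :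
    X ≤ B * M := by
  refine le_of_pow_le_pow_left₀ (n := 2) (by norm_num) (by positivity) ?_
  refine le_of_mul_le_mul_left ?_ hT
  calc T * X ^ 2 ≤ p * E := h1
    _ ≤ p * (M * Y) := by gcongr
    _ = M * (p * Y) := by ring
    _ ≤ M * (T * B ^ 2) := by gcongr
    _ ≤ (M * M) * (T * B ^ 2) := by gcongr; nlinarith
    _ = _ := by ring

theorem norm_doubleSubgroupSum_le {p : ℕ} [Fact p.Prime] (G : Subgroup (ZMod p)ˣ)
    (hG : (Nat.card G : ℝ) ≤ (p : ℝ) ^ (2 / 3 : ℝ)) {a : ZMod p} (ha : a ≠ 0)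
    {χ : MulChar (ZMod p) ℂ} (hχ : χ ≠ 1) :
    ‖doubleSubgroupSum p χ a G‖ ≤ doubleSubgroupBound p (Nat.card G) (lossExponent p) := by
  have hp2 : 2 ≤ p := (Fact.out : p.Prime).two_le
  have hp1 : 1 ≤ p := by omega
  obtain ⟨hcard, hsum⟩ := doubleSubgroupSum_eq χ a G
  have hT : 1 ≤ Nat.card G := Nat.card_pos
  set T := Nat.card G with hTdef
  have hX := card_mul_norm_doubleSum_sq_le hT hcard hχ ha
  rw [← hsum] at hX
  have hpR : (0 : ℝ) < p := by exact_mod_cast hp1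
  have hTR : (0 : ℝ) < T := by exact_mod_cast hT
  have hpow : ∀ (n : ℕ) (x : ℝ), Real.exp x ^ n = Real.exp (n * x) := fun n x =>
    (Real.exp_nat_mul x n).symm
  have hTp : T ^ 3 ≤ p ^ 2 := by
    have h1 : (T : ℝ) ^ 3 ≤ ((p : ℝ) ^ (2 / 3 : ℝ)) ^ 3 := by gcongr
    rw [← Real.rpow_natCast, ← Real.rpow_natCast, ← Real.rpow_mul hpR.le] at h1
    norm_num at h1
    exact_mod_cast h1
  set L := Nat.log 2 p + 1 with hLdef
  have hTlep : T ≤ p := by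
    by_contra! h
    have h1 : p ^ 3 < T ^ 3 := Nat.pow_lt_pow_left h (by norm_num)
    have h2 : p ^ 2 ≤ p ^ 3 := Nat.pow_le_pow_right hp1 (by norm_num)
    omega
  have hL : T < 2 ^ L := hTlep.trans_lt (Nat.lt_pow_succ_log_self (by norm_num) p)
  have hM : (2 ^ 20 * L ^ 2 : ℝ) ≤ logLoss p := by
    rw [logLoss]
    gcongr
    exact natLog_add_one_le hp1
  have hM1 : 1 ≤ logLoss p := one_le_logLoss (by exact_mod_cast hp1)
  have hMp := rpow_lossExponent hp2
  rw [natCast_rpow_eq hp1] at hMp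
  set E := diffEnergy (torsionSet p T) with hE
  have hTe : Real.exp (Real.log T) = T := Real.exp_log hTR
  have hpe : Real.exp (Real.log p) = p := Real.exp_log hpR
  set t := Real.log T with ht
  set s := Real.log p with hs
  set M := logLoss p with hMdef
  rw [doubleSubgroupBound_eq hp1 hT]
  rw [← hTe, ← hpe] at hX
  split_ifs with hc1 hc2
  · have hsq : T ^ 2 ≤ p := by
      have h1 : Real.exp (2 * t) ≤ Real.exp s := Real.exp_le_exp.2 (by linarith)
      rw [two_mul, Real.exp_add, hTe, hpe, ← sq] at h1
      exact_mod_cast h1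
    have hE26 : (E : ℝ) ^ 26 ≤ (M * Real.exp (32 / 13 * t)) ^ 26 := by
      calc (E : ℝ) ^ 26 ≤ (2 ^ 20 * L ^ 2) ^ 26 * T ^ 64 := by
            exact_mod_cast diffEnergy_pow_le_of_sq_le hT hsq hcard hL
        _ ≤ M ^ 26 * T ^ 64 := by gcongr
        _ = _ := by rw [mul_pow, hpow, ← hTe, hpow]; congr 2; push_cast; ring
    have hEle := le_of_pow_le_pow_left₀ (by norm_num) (by positivity) hE26
    have := le_of_mul_sq_le (B := Real.exp (19 / 26 * t + 1 / 2 * s)) (Real.exp_pos t)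
      (Real.exp_pos s).le hM1 (Real.exp_pos _).le hX hEle (by
        rw [hpow, ← Real.exp_add, ← Real.exp_add, Real.exp_le_exp]; push_cast; linarith)
    rw [← hMp, ← Real.exp_add] at this
    convert this using 2; ring
  all_goals
    have hEle : (E : ℝ) ≤ M * Real.exp (3 * t - 1 / 3 * s) ∨
        (E : ℝ) ≤ M * Real.exp (31 / 13 * t + 1 / 26 * s) := by
      rcases diffEnergy_pow_le hT hTp hcard hL with h | h
      · left
        have h3 : (E : ℝ) ^ 3 ≤ (M * Real.exp (3 * t - 1 / 3 * s)) ^ 3 := by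
          have h4 : (E : ℝ) ^ 3 * Real.exp s ≤ M ^ 3 * Real.exp (9 * t) := by
            calc (E : ℝ) ^ 3 * Real.exp s ≤ (2 ^ 20 * L ^ 2) ^ 3 * T ^ 9 := by
                  rw [hpe]; exact_mod_cast h
              _ ≤ M ^ 3 * T ^ 9 := by gcongr
              _ = _ := by rw [← hTe, hpow]; congr 2
          refine le_of_mul_le_mul_right (h4.trans_eq ?_) (Real.exp_pos s)
          rw [mul_pow, hpow, mul_assoc, ← Real.exp_add]
          congr 2; push_cast; ring
        exact le_of_pow_le_pow_left₀ (by norm_num) (by positivity) h3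
      · right
        have h3 : (E : ℝ) ^ 26 ≤ (M * Real.exp (31 / 13 * t + 1 / 26 * s)) ^ 26 := by
          calc (E : ℝ) ^ 26 ≤ (2 ^ 20 * L ^ 2) ^ 26 * (T ^ 62 * p) := by exact_mod_cast h
            _ ≤ M ^ 26 * (T ^ 62 * p) := by gcongr
            _ = _ := by
              rw [mul_pow, hpow, ← hTe, ← hpe, hpow, ← Real.exp_add]
              congr 2; push_cast; ring
        exact le_of_pow_le_pow_left₀ (by norm_num) (by positivity) h3
  · have : ‖doubleSubgroupSum p χ a G‖ ≤ Real.exp (9 / 13 * t + 27 / 52 * s) * M := by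
      rcases hEle with h | h
      · exact le_of_mul_sq_le (Real.exp_pos t) (Real.exp_pos s).le hM1 (Real.exp_pos _).le
          hX h (by
            rw [hpow, ← Real.exp_add, ← Real.exp_add, Real.exp_le_exp]; push_cast; linarith)
      · exact le_of_mul_sq_le (Real.exp_pos t) (Real.exp_pos s).le hM1 (Real.exp_pos _).le
          hX h (by
            rw [hpow, ← Real.exp_add, ← Real.exp_add, Real.exp_le_exp]; push_cast; linarith)
    rw [← hMp, ← Real.exp_add] at this
    convert this using 2; ring
  · have : ‖doubleSubgroupSum p χ a G‖ ≤ Real.exp (t + 1 / 3 * s) * M := by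
      rcases hEle with h | h
      · exact le_of_mul_sq_le (Real.exp_pos t) (Real.exp_pos s).le hM1 (Real.exp_pos _).le
          hX h (by
            rw [hpow, ← Real.exp_add, ← Real.exp_add, Real.exp_le_exp]; push_cast; linarith)
      · exact le_of_mul_sq_le (Real.exp_pos t) (Real.exp_pos s).le hM1 (Real.exp_pos _).le
          hX h (by
            rw [hpow, ← Real.exp_add, ← Real.exp_add, Real.exp_le_exp]; push_cast; linarith)
    rw [← hMp, ← Real.exp_add] at this
    convert this using 2; ring

theorem doubleSubgroupBound_le {p T : ℕ} (hp : 1 ≤ p) {ε η e : ℝ}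
    (hε : 0 ≤ ε) (hη : η ≤ ε / 2) (hη' : η ≤ 1 / 20) (he : e ≤ η)
    (hT : (p : ℝ) ^ (13 / 33 + ε : ℝ) ≤ T) :
    doubleSubgroupBound p T e ≤ (T : ℝ) ^ 2 * (p : ℝ) ^ (-η) := by
  have hpR : (0 : ℝ) < p := by exact_mod_cast hp
  have hT0 : (0 : ℝ) < T := (Real.rpow_pos_of_pos hpR _).trans_le hT
  have hT1 : 1 ≤ T := by exact_mod_cast hT0
  have hs : 0 ≤ Real.log p := Real.log_natCast_nonneg p
  have ht : (13 / 33 + ε) * Real.log p ≤ Real.log T := by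
    rw [natCast_rpow_eq hp] at hT
    exact (Real.le_log_iff_exp_le hT0).2 hT
  have hR : (T : ℝ) ^ 2 * (p : ℝ) ^ (-η) = Real.exp (2 * Real.log T + -η * Real.log p) := by
    rw [Real.exp_add, natCast_rpow_eq hp, two_mul, Real.exp_add, Real.exp_log hT0, sq]
  rw [hR, doubleSubgroupBound_eq hp hT1]
  have h1 : e * Real.log p ≤ η * Real.log p := by gcongr
  have h2 : η * Real.log p ≤ ε / 2 * Real.log p := by gcongr
  have h3 : η * Real.log p ≤ 1 / 20 * Real.log p := by gcongr
  have h4 : 0 ≤ ε * Real.log p := mul_nonneg hε hs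
  split_ifs with hc1 hc2
  · rw [Real.exp_le_exp]; nlinarith
  · rw [Real.exp_le_exp]; nlinarith
  · rw [Real.exp_le_exp]; nlinarith

theorem theorem4 :
    ∃ δ : ℕ → ℝ, Tendsto δ atTop (𝓝 0) ∧
      (∀ (p : ℕ) [Fact p.Prime] (G : Subgroup (ZMod p)ˣ),
        (Nat.card G : ℝ) ≤ (p : ℝ) ^ (2 / 3 : ℝ) →
        ∀ a : ZMod p, a ≠ 0 → ∀ χ : MulChar (ZMod p) ℂ, χ ≠ 1 →
          ‖doubleSubgroupSum p χ a G‖ ≤ doubleSubgroupBound p (Nat.card G) (δ p)) ∧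
      (∀ ε : ℝ, 0 < ε → ∃ η : ℝ, 0 < η ∧ ∃ P : ℕ, ∀ p : ℕ, p.Prime → P ≤ p → ∀ T : ℕ,
        (p : ℝ) ^ (13 / 33 + ε : ℝ) ≤ (T : ℝ) → (T : ℝ) ≤ (p : ℝ) ^ (2 / 3 : ℝ) →
          doubleSubgroupBound p T (δ p) ≤ (T : ℝ) ^ 2 * (p : ℝ) ^ (-η)) := by
  refine ⟨lossExponent, tendsto_lossExponent,
    fun p _ G hG a ha χ hχ => norm_doubleSubgroupSum_le G hG ha hχ, fun ε hε => ?_⟩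
  have hη : 0 < min (ε / 2) (1 / 20) := lt_min (by linarith) (by norm_num)
  obtain ⟨P, hP⟩ := eventually_atTop.1 (tendsto_lossExponent.eventually_lt_const hη)
  exact ⟨_, hη, P, fun p hp hPp T hT _ => doubleSubgroupBound_le hp.pos hε.le (min_le_left _ _)
    (min_le_right _ _) (hP p hPp).le hT⟩
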